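/- Let $l\ge 0$ and let $(M_1,g_1),\dots,(M_l,g_l)$ be closed (compact, without boundary) connected smooth Riemannian manifolds of dimensions $m_1,\dots,m_l\ge 1$, let $M=M_1\times\cdots\times M_l$ and let $g=g_1\oplus\cdots\oplus g_l$ be the direct product metric. Let $f_1,\dots,f_l\colon M\to\mathbb{R}$ be smooth and positive, and let $\tilde g=f_1^2g_1\oplus\cdots\oplus f_l^2g_l$. Write $R^h$ for the scalar curvature of a metric $h$, and assume that $R^{g_i}\ge 0$ on $M_i$ for every $i$. (a) Suppose that $\tilde g$ is of permutation type: there is a bijection $\sigma$ of $\{1,\dots,l\}$ such that, for every $i$, $f_i$ is constant along the product of all the factors other than $M_{\sigma(i)}$ (that is, $f_i$ depends only on the point of $M_{\sigma(i)}$). If $R^{\tilde g}\le 0$ everywhere, then $R^{\tilde g}\equiv R^g\equiv 0$, and $f_i$ is constant for every $i$ except possibly for those $i$ with $\sigma(i)=i$ and $m_i=1$. In particular, if no such $i$ exists (for instance if all $m_i\ge 2$, or if $\sigma$ has no fixed point), then $f_1,\dots,f_l$ are all constant. (b) Suppose that $l=2$ and that $f_i$ is constant along $M_i$ for $i=1,2$.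 Then $R^{\tilde g}$ cannot be nonpositive everywhere and negative somewhere. -/

import Mathlib

open scoped Manifold ContDiff

set_option maxSynthPendingDepth 3

noncomputable section

namespace Multiconformal

section Coordinates

variable {E : Type*} [NormedAddCommGroup E] [NormedSpace ℝ E]

/-- The Koszul expression of a metric `G` given in coordinates (a field of bilinear forms on the
vector space `E`): for constant vector fields `u, v, w`, it is
`∂_u G(v, w) + ∂_v G(u, w) - ∂_w G(u, v)`. -/
def koszul (G : E → E →L[ℝ] E →L[ℝ] ℝ) (y : E) : E →L[ℝ] E →L[ℝ] (E →L[ℝ] ℝ) :=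
  fderiv ℝ G y + (fderiv ℝ G y).flip
    - ((ContinuousLinearMap.flipₗᵢ ℝ E E ℝ : (E →L[ℝ] E →L[ℝ] ℝ) →L[ℝ] (E →L[ℝ] E →L[ℝ] ℝ)).comp
        (fderiv ℝ G y).flip)

theorem koszul_apply (G : E → E →L[ℝ] E →L[ℝ] ℝ) (y u v w : E) :
    koszul G y u v w = fderiv ℝ G y u v w + fderiv ℝ G y v u w - fderiv ℝ G y w u v := by
  simp [koszul]

/-- The Christoffel symbols `Γ(u, v) = ∇_u v` (for constant fields `u, v`) of the Levi-Civita
connection of `G`: the vector with `G(Γ(u, v), w) = koszul G u v w / 2` for all `w`. Here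
`(G y).inverse` is the inverse of the isomorphism `E → E*` given by `G y` (raising the index). -/
def christoffel (G : E → E →L[ℝ] E →L[ℝ] ℝ) (y : E) : E →L[ℝ] E →L[ℝ] E :=
  (1 / 2 : ℝ) •
    (ContinuousLinearMap.compL ℝ E (E →L[ℝ] ℝ) E (G y).inverse).comp (koszul G y)

theorem christoffel_apply (G : E → E →L[ℝ] E →L[ℝ] ℝ) (y u v : E) :
    christoffel G y u v = (1 / 2 : ℝ) • (G y).inverse (koszul G y u v) := by
  simp [christoffel]

/-- The curvature `u ↦ R(u, v) w`, where `R(u, v) w = ∇_u ∇_v w - ∇_v ∇_u w` for constant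
fields. -/
def curvature (G : E → E →L[ℝ] E →L[ℝ] ℝ) (y v w : E) : E →ₗ[ℝ] E where
  toFun u :=
    fderiv ℝ (christoffel G) y u v w - fderiv ℝ (christoffel G) y v u w
      + christoffel G y u (christoffel G y v w) - christoffel G y v (christoffel G y u w)
  map_add' a b := by
    simp only [map_add, add_apply]
    abel
  map_smul' c a := by
    simp only [map_smul, smul_apply, RingHom.id_apply, smul_sub, smul_add]

/-- The Ricci curvature `Ric(v, w) = tr (u ↦ R(u, v) w)`. -/
def ricci (G : E → E →L[ℝ] E →L[ℝ] ℝ) (y v : E) : E →ₗ[ℝ] ℝ where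
  toFun w := LinearMap.trace ℝ E (curvature G y v w)
  map_add' a b := by
    rw [← map_add]
    congr 1
    ext u
    simp only [curvature, LinearMap.coe_mk, AddHom.coe_mk, LinearMap.add_apply, map_add]
    abel
  map_smul' c a := by
    rw [RingHom.id_apply, ← map_smul]
    congr 1
    ext u
    simp only [curvature, LinearMap.coe_mk, AddHom.coe_mk, LinearMap.smul_apply, map_smul,
      smul_sub, smul_add]

variable [FiniteDimensional ℝ E]

/-- The Ricci curvature with one index raised, `v ↦ Ric(v, ·)♯`. -/
def ricciSharp (G : E → E →L[ℝ] E →L[ℝ] ℝ) (y : E) : E →ₗ[ℝ] E where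
  toFun v := (G y).inverse (LinearMap.toContinuousLinearMap (ricci G y v))
  map_add' a b := by
    rw [← map_add, ← map_add]
    congr 2
    ext w
    change LinearMap.trace ℝ E _ = LinearMap.trace ℝ E _ + LinearMap.trace ℝ E _
    rw [← map_add]
    congr 1
    ext u
    simp only [curvature, LinearMap.coe_mk, AddHom.coe_mk, LinearMap.add_apply, map_add,
      add_apply]
    abel
  map_smul' c a := by
    rw [RingHom.id_apply, ← map_smul, ← map_smul]
    congr 2
    ext w
    change LinearMap.trace ℝ E _ = c • LinearMap.trace ℝ E _
    rw [← map_smul]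
    congr 1
    ext u
    simp only [curvature, LinearMap.coe_mk, AddHom.coe_mk, LinearMap.smul_apply, map_smul,
      smul_sub, smul_add, smul_apply]

/-- The scalar curvature at `y` of a metric given in coordinates: the trace of the Ricci curvature
with respect to the metric. -/
def coordScalarCurvature (G : E → E →L[ℝ] E →L[ℝ] ℝ) (y : E) : ℝ :=
  LinearMap.trace ℝ E (ricciSharp G y)

end Coordinates

section Pullback

variable {V W : Type*} [AddCommGroup V] [Module ℝ V] [TopologicalSpace V]
  [AddCommGroup W] [Module ℝ W] [TopologicalSpace W]

/-- The pullback `(v, w) ↦ B (D v, D w)` of a bilinear form `B` by a linear map `D`. -/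
def pullback (D : V →L[ℝ] W) (B : W →L[ℝ] W →L[ℝ] ℝ) : V →L[ℝ] V →L[ℝ] ℝ :=
  (D.precomp ℝ).comp (B.comp D)

theorem pullback_apply (D : V →L[ℝ] W) (B : W →L[ℝ] W →L[ℝ] ℝ) (v w : V) :
    pullback D B v w = B (D v) (D w) := rfl

end Pullback

section Manifold

variable {E : Type*} [NormedAddCommGroup E] [NormedSpace ℝ E]
  {H : Type*} [TopologicalSpace H] (I : ModelWithCorners ℝ E H)
  {M : Type*} [TopologicalSpace M] [ChartedSpace H M]

/-- Fields of bilinear forms on the tangent spaces of a manifold, such as Riemannian metrics. -/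
abbrev BilinField : Type _ :=
  ∀ x : M, TangentSpace I x →L[ℝ] TangentSpace I x →L[ℝ] ℝ

variable {I}

/-- The expression of `g` in the preferred chart at `p`: the pullback of `g` by the inverse of the
chart. -/
def inChart (g : BilinField I (M := M)) (p : M) (y : E) : E →L[ℝ] E →L[ℝ] ℝ :=
  pullback (mfderiv 𝓘(ℝ, E) I (extChartAt I p).symm y) (g ((extChartAt I p).symm y))

theorem inChart_apply (g : BilinField I (M := M)) (p : M) (y v w : E) :
    inChart g p y v w =
      g ((extChartAt I p).symm y) (mfderiv 𝓘(ℝ, E) I (extChartAt I p).symm y v)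
        (mfderiv 𝓘(ℝ, E) I (extChartAt I p).symm y w) := rfl

/-- The scalar curvature at the point `p` of a metric `g` on a manifold without boundary, computed
in the preferred chart at `p`. -/
def scalarCurvature [FiniteDimensional ℝ E] (g : BilinField I (M := M)) (p : M) : ℝ :=
  coordScalarCurvature (inChart g p) (extChartAt I p p)

end Manifold

section Product

variable {ι : Type*} [Fintype ι] {E : ι → Type*} [∀ i, NormedAddCommGroup (E i)]
  [∀ i, NormedSpace ℝ (E i)] {H : ι → Type*} [∀ i, TopologicalSpace (H i)]
  {I : ∀ i, ModelWithCorners ℝ (E i) (H i)} {M : ι → Type*} [∀ i, TopologicalSpace (M i)]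
  [∀ i, ChartedSpace (H i) (M i)]

/-- The multiconformal metric `f₁² g₁ ⊕ ⋯ ⊕ f_l² g_l` on the product manifold, that is
`∑ i, f_i² π_i^* g_i` with `π_i` the projection onto the `i`-th factor. -/
def multiconformal (f : ι → (∀ i, M i) → ℝ) (g : ∀ i, BilinField (I i) (M := M i)) :
    BilinField (ModelWithCorners.pi I) (M := ∀ i, M i) := fun x =>
  ∑ i, (f i x) ^ 2 •
    pullback (mfderiv (ModelWithCorners.pi I) (I i) (fun z : ∀ j, M j => z i) x) (g i (x i))

theorem multiconformal_apply (f : ι → (∀ i, M i) → ℝ) (g : ∀ i, BilinField (I i) (M := M i))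
    (x : ∀ i, M i) (v w : TangentSpace (ModelWithCorners.pi I) x) :
    multiconformal f g x v w = ∑ i, (f i x) ^ 2 *
      g i (x i) (mfderiv (ModelWithCorners.pi I) (I i) (fun z : ∀ j, M j => z i) x v)
        (mfderiv (ModelWithCorners.pi I) (I i) (fun z : ∀ j, M j => z i) x w) := by
  simp [multiconformal, sum_apply, smul_apply, pullback_apply]

/-- The direct product metric `g₁ ⊕ ⋯ ⊕ g_l`. -/
def productMetric (g : ∀ i, BilinField (I i) (M := M i)) :
    BilinField (ModelWithCorners.pi I) (M := ∀ i, M i) :=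
  multiconformal (fun _ _ => 1) g

end Product

section Types

variable {ι : Type*} {M : ι → Type*}

/-- `f₁² g₁ ⊕ ⋯ ⊕ f_l² g_l` has type `σ`: each `f i` is constant along
the product of all factors other than `M (σ i)`, i.e. depends on the `σ i`-th coordinate only. -/
def HasType (f : ι → (∀ i, M i) → ℝ) (σ : ι → ι) : Prop :=
  ∀ i, ∀ x y : ∀ i, M i, x (σ i) = y (σ i) → f i x = f i y

/-- `f₁² g₁ ⊕ ⋯ ⊕ f_l² g_l` has off-diagonal type: each `f i` is constant along `M i`. -/
def IsOffDiagonal (f : ι → (∀ i, M i) → ℝ) : Prop :=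
  ∀ i, ∀ x y : ∀ i, M i, (∀ j, j ≠ i → x j = y j) → f i x = f i y

end Types

end Multiconformal

end

/-! Write `u_k = log f_k`, a function on the factor `M_{σ(k)}`, and let `R_j` be the scalar
curvature of `g_j`. The core is the identity `R^{g̃} = ∑ j, f_j⁻² R_j - ∑ k, f_{σ(k)}⁻² A_k`, with
`A_k = α_k Δu_k + β_k |∇u_k|²` on `M_{σ(k)}`. Since `σ` is a bijection, each factor carries the
differential of exactly one `u_k`, so no mixed gradient products survive. Here `α_k = 2 m_k` and
`β_k = m_k + m_k²`; if `σ(k) = k` they drop to `2 (m_k - 1)` and `(m_k - 1)(m_k - 2)`, as in the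
classical conformal law.

Let every `u_l` sit at a maximum point, where `A_l ≤ 0`. Moving only the coordinate in `M_{σ(k)}`,
the inequalities `R^{g̃} ≤ 0` and `R_j ≥ 0` force `A_k ≥ 0` at every point of `M_{σ(k)}`. If `α_k >
0`, this makes `u_k` a subsolution on a closed connected manifold, and the strong maximum principle
(`exists_eq_const_of_subsolution`) makes it constant. If `α_k = 0`, which means `σ(k) = k` and `m_k
= 1`, then `β_k = 0` too. So every `A_k` vanishes, `R^{g̃}` is a sum of nonnegative terms, and all
of them are zero (`rigidity_of_hasType`). Part (b) is the case of the transposition.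

The curvature identity is proved in coordinates for arbitrary factors `exp φ_k`. The Levi-Civita
connection differs from that of the product metric by a tensor `S` (`christoffel_multiMetric`), the
curvature follows from covariant derivatives of `S` and quadratic terms in `S`
(`curvature_multiMetric`), and two traces give `coordScalarCurvature_multiMetric`. The permutation
hypothesis enters only afterwards, in `coordScalarCurvature_of_permutation`. -/

noncomputable section

namespace Multiconformal

open Filter Topology

/-! ### Metrics in coordinates: connection, Hessian and Laplacian -/

section CoordinateMetric

variable {E : Type*} [NormedAddCommGroup E] [NormedSpace ℝ E]

/-- `G` is, near `y`, a twice differentiable field of nondegenerate symmetric bilinear forms. -/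
structure IsMetricAt (G : E → E →L[ℝ] E →L[ℝ] ℝ) (y : E) : Prop where
  contDiffAt : ContDiffAt ℝ 2 G y
  symm : ∀ᶠ z in 𝓝 y, ∀ v w, G z v w = G z w v
  isInvertible : (G y).IsInvertible

/-- The Hessian `∇²U (v, w) = D²U (v, w) - DU (Γ(v, w))`. -/
def hessian (G : E → E →L[ℝ] E →L[ℝ] ℝ) (U : E → ℝ) (y : E) : E →L[ℝ] E →L[ℝ] ℝ :=
  fderiv ℝ (fderiv ℝ U) y -
    (ContinuousLinearMap.compL ℝ E E ℝ (fderiv ℝ U y)).comp (christoffel G y)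

theorem hessian_apply (G : E → E →L[ℝ] E →L[ℝ] ℝ) (U : E → ℝ) (y v w : E) :
    hessian G U y v w =
      fderiv ℝ (fderiv ℝ U) y v w - fderiv ℝ U y (christoffel G y v w) := by
  simp [hessian]

/-- The trace of a bilinear form `B` with respect to a scalar product `g`. -/
def metricTrace (g B : E →L[ℝ] E →L[ℝ] ℝ) : ℝ :=
  LinearMap.trace ℝ E ((g.inverse.comp B : E →L[ℝ] E) : E →ₗ[ℝ] E)

/-- The Laplacian of `U` with respect to the metric `G`. -/
def laplacian (G : E → E →L[ℝ] E →L[ℝ] ℝ) (U : E → ℝ) (y : E) : ℝ :=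
  metricTrace (G y) (hessian G U y)

theorem metricTrace_add (g B C : E →L[ℝ] E →L[ℝ] ℝ) :
    metricTrace g (B + C) = metricTrace g B + metricTrace g C := by
  simp [metricTrace, ContinuousLinearMap.comp_add]

theorem metricTrace_sub (g B C : E →L[ℝ] E →L[ℝ] ℝ) :
    metricTrace g (B - C) = metricTrace g B - metricTrace g C := by
  simp [metricTrace, ContinuousLinearMap.comp_sub]

theorem metricTrace_smul (g B : E →L[ℝ] E →L[ℝ] ℝ) (c : ℝ) :
    metricTrace g (c • B) = c * metricTrace g B := by
  simp [metricTrace]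

theorem metricTrace_sum {κ : Type*} (s : Finset κ) (g : E →L[ℝ] E →L[ℝ] ℝ)
    (B : κ → E →L[ℝ] E →L[ℝ] ℝ) :
    metricTrace g (∑ k ∈ s, B k) = ∑ k ∈ s, metricTrace g (B k) := by
  classical
  induction s using Finset.induction_on with
  | empty => simp [metricTrace]
  | insert a s ha ih => rw [Finset.sum_insert ha, Finset.sum_insert ha, metricTrace_add, ih]

theorem metricTrace_self {g : E →L[ℝ] E →L[ℝ] ℝ} [FiniteDimensional ℝ E] (hg : g.IsInvertible) :
    metricTrace g g = Module.finrank ℝ E := by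
  rw [metricTrace, hg.inverse_comp_self]
  exact LinearMap.trace_id ℝ E

theorem metricTrace_smulRight [FiniteDimensional ℝ E] (g : E →L[ℝ] E →L[ℝ] ℝ) (a c : E →L[ℝ] ℝ) :
    metricTrace g (a.smulRight c) = a (g.inverse c) := by
  have h : ((g.inverse.comp (a.smulRight c) : E →L[ℝ] E) : E →ₗ[ℝ] E) =
      (a : E →ₗ[ℝ] ℝ).smulRight (g.inverse c) := by
    ext v
    simp
  rw [metricTrace, h, LinearMap.trace_smulRight]
  rfl

variable {G : E → E →L[ℝ] E →L[ℝ] ℝ} {y : E}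

theorem apply_christoffel (hG : (G y).IsInvertible) (u v w : E) :
    G y (christoffel G y u v) w = (1 / 2 : ℝ) * koszul G y u v w := by
  rw [christoffel_apply, map_smul, hG.self_apply_inverse]
  simp

/-- Nondegeneracy makes the Koszul formula characterize the connection, so a candidate can be
checked by pairing it with test vectors, without computing an inverse metric. -/
theorem christoffel_eq_of_forall (hG : (G y).IsInvertible) {u v x : E}
    (h : ∀ w, G y x w = (1 / 2 : ℝ) * koszul G y u v w) : christoffel G y u v = x := by
  apply hG.injective
  ext w
  rw [apply_christoffel hG, h]

theorem hasFDerivAt_metric_apply (hd : DifferentiableAt ℝ G y) (v w : E) :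
    HasFDerivAt (fun z => G z v w)
      ((ContinuousLinearMap.apply ℝ ℝ w).comp
        ((ContinuousLinearMap.apply ℝ (E →L[ℝ] ℝ) v).comp (fderiv ℝ G y))) y := by
  exact ((ContinuousLinearMap.apply ℝ ℝ w).hasFDerivAt.comp y
    ((ContinuousLinearMap.apply ℝ (E →L[ℝ] ℝ) v).hasFDerivAt.comp y hd.hasFDerivAt))

namespace IsMetricAt

theorem differentiableAt (h : IsMetricAt G y) : DifferentiableAt ℝ G y :=
  h.contDiffAt.differentiableAt (by norm_num)

theorem fderiv_symm (h : IsMetricAt G y) (u v w : E) :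
    fderiv ℝ G y u v w = fderiv ℝ G y u w v := by
  have h1 := hasFDerivAt_metric_apply h.differentiableAt v w
  have h2 := hasFDerivAt_metric_apply h.differentiableAt w v
  have h3 : (fun z => G z v w) =ᶠ[𝓝 y] fun z => G z w v := by
    filter_upwards [h.symm] with z hz using hz v w
  have := DFunLike.congr_fun (h1.unique (h2.congr_of_eventuallyEq h3)) u
  simpa using this

theorem christoffel_symm (h : IsMetricAt G y) (u v : E) :
    christoffel G y u v = christoffel G y v u := by
  rw [christoffel_apply, christoffel_apply]
  congr 2
  ext w
  rw [koszul_apply, koszul_apply, h.fderiv_symm w u v]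
  ring

/-- Compatibility of the connection with the metric, `∇G = 0`: in the sum of the two Koszul
expressions everything cancels but twice the derivative along `u`. -/
theorem fderiv_eq (h : IsMetricAt G y) (u v w : E) :
    fderiv ℝ G y u v w = G y (christoffel G y u v) w + G y v (christoffel G y u w) := by
  rw [h.symm.self_of_nhds v, apply_christoffel h.isInvertible, apply_christoffel h.isInvertible,
    koszul_apply, koszul_apply, h.fderiv_symm u w v, h.fderiv_symm v u w, h.fderiv_symm w u v]
  ring

theorem differentiableAt_koszul (h : IsMetricAt G y) : DifferentiableAt ℝ (koszul G) y := by
  have h1 : DifferentiableAt ℝ (fderiv ℝ G) y :=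
    (h.contDiffAt.fderiv_right (m := 1) (by norm_num)).differentiableAt (by norm_num)
  have h2 : DifferentiableAt ℝ (fun z => (fderiv ℝ G z).flip) y :=
    (ContinuousLinearMap.flipₗᵢ ℝ E E (E →L[ℝ] ℝ)).differentiableAt.comp y h1
  unfold koszul
  exact (h1.add h2).sub (((differentiableAt_const _).clm_comp h2))

variable [FiniteDimensional ℝ E]

/-- Invertible operators form an open set. Curvature differentiates the Christoffel symbols, so
formulas for them are needed on a neighbourhood and not just at the point. -/
theorem eventually (h : IsMetricAt G y) : ∀ᶠ z in 𝓝 y, IsMetricAt G z := by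
  have : CompleteSpace E := FiniteDimensional.complete ℝ E
  have hopen : ∀ᶠ z in 𝓝 y, (G z).IsInvertible := by
    obtain ⟨e, he⟩ := h.isInvertible
    refine h.contDiffAt.continuousAt.eventually
      (p := fun B => B ∈ Set.range ((↑) : (E ≃L[ℝ] (E →L[ℝ] ℝ)) → (E →L[ℝ] (E →L[ℝ] ℝ)))) ?_
    rw [← he]
    exact ContinuousLinearEquiv.nhds e
  filter_upwards [h.contDiffAt.eventually (by norm_num), h.symm.eventually_nhds, hopen]
    with z h1 h2 h3 using ⟨h1, h2, h3⟩

theorem differentiableAt_inverse (h : IsMetricAt G y) :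
    DifferentiableAt ℝ (fun z => (G z).inverse) y := by
  have : CompleteSpace E := FiniteDimensional.complete ℝ E
  exact ((h.isInvertible.contDiffAt_map_inverse (n := 2)).comp y h.contDiffAt).differentiableAt
    (by norm_num)

theorem differentiableAt_christoffel (h : IsMetricAt G y) :
    DifferentiableAt ℝ (christoffel G) y := by
  unfold christoffel
  refine DifferentiableAt.fun_const_smul (DifferentiableAt.clm_comp ?_ h.differentiableAt_koszul) _
  exact (ContinuousLinearMap.differentiableAt _).comp y h.differentiableAt_inverse

end IsMetricAt

end CoordinateMetric

end Multiconformal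

namespace Multiconformal

open Filter Topology

/-! ### Linear algebra of the connection difference tensor -/

section Shape

variable {V κ : Type*} [AddCommGroup V] [Module ℝ V] [Fintype κ]
  (a : κ → V →ₗ[ℝ] ℝ) (P : κ → V →ₗ[ℝ] V) (b : κ → V →ₗ[ℝ] V →ₗ[ℝ] ℝ) (N : κ → V)

/-- The map `w ↦ ∑ k, a_k(v) P_k w + a_k(w) P_k v - b_k(v, w) N_k`. -/
def shape (v : V) : V →ₗ[ℝ] V :=
  ∑ k, (a k v • P k + (a k).smulRight (P k v) - (b k v).smulRight (N k))

theorem shape_apply (v w : V) :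
    shape a P b N v w = ∑ k, (a k v • P k w + a k w • P k v - b k v w • N k) := by
  simp [shape, LinearMap.sum_apply]

variable {a P b N}

theorem shape_symm (hb : ∀ k v w, b k v w = b k w v) (v w : V) :
    shape a P b N v w = shape a P b N w v := by
  rw [shape_apply, shape_apply]
  refine Finset.sum_congr rfl fun k _ => ?_
  rw [hb k v w, add_comm (a k v • _)]

/-- For a vector in one block the tensor is a block-scalar map plus two maps of rank one, which is
what makes traces of products computable. -/
theorem shape_of_mem_block [DecidableEq κ] {i : κ} {v : V} (hv : ∀ k, P k v = if k = i then v else 0)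
    (hb : ∀ k, k ≠ i → b k v = 0) :
    shape a P b N v =
      ∑ k, a k v • P k + (a i).smulRight v - (b i v).smulRight (N i) := by
  rw [shape, Finset.sum_sub_distrib, Finset.sum_add_distrib]
  congr 1
  · congr 1
    rw [Finset.sum_eq_single i]
    · simp [hv]
    · intro k _ hk
      ext u
      simp [hv, hk]
    · simp
  · rw [Finset.sum_eq_single i]
    · intro k _ hk
      ext u
      simp [hb k hk]
    · simp

variable [FiniteDimensional ℝ V]

/-- The two rank-one parts have traces `a_k (P_k z)` and `b_k (z, N_k)`; these cancel because `N_k`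
represents `a_k` on its own block. -/
theorem trace_shape {m : κ → ℝ} (hm : ∀ k, LinearMap.trace ℝ V (P k) = m k)
    {z : V} (hz : ∀ k, a k (P k z) = b k z (N k)) :
    LinearMap.trace ℝ V (shape a P b N z) = ∑ k, m k * a k z := by
  simp only [shape, map_sum, map_sub, map_add, map_smul, LinearMap.trace_smulRight, hm, hz,
    smul_eq_mul]
  exact Finset.sum_congr rfl fun k _ => by ring

variable [DecidableEq κ]

/-- Both factors are block-scalar plus rank one. The orthogonal projections give the sum, and each
product involving a rank-one map has as its trace one evaluation of the functional. -/
theorem trace_shape_comp_shape {m : κ → ℝ} (hm : ∀ k, LinearMap.trace ℝ V (P k) = m k)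
    (hP : ∀ k l, P k ∘ₗ P l = if k = l then P k else 0) {i : κ} {v w : V}
    (hv : ∀ k, P k v = if k = i then v else 0) (hw : ∀ k, P k w = if k = i then w else 0)
    (hbv : ∀ k, k ≠ i → b k v = 0) (hbw : ∀ k, k ≠ i → b k w = 0)
    (hsymm : b i v w = b i w v)
    (hNv : ∀ k, b i v (P k (N i)) = if k = i then a i v else 0)
    (hNw : ∀ k, b i w (P k (N i)) = if k = i then a i w else 0)
    (hNv' : b i v (N i) = a i v) (hNw' : b i w (N i) = a i w) :
    LinearMap.trace ℝ V (shape a P b N v ∘ₗ shape a P b N w) =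
      ∑ k, m k * (a k v * a k w) + 2 * (a i v * a i w) - 2 * (b i v w * a i (N i)) := by
  have h1 : ∀ (ℓ : V →ₗ[ℝ] ℝ) (x : V) (L : V →ₗ[ℝ] V),
      LinearMap.trace ℝ V (ℓ.smulRight x ∘ₗ L) = ℓ (L x) := fun ℓ x L => by
    exact LinearMap.trace_smulRight (ℓ ∘ₗ L) x
  have h2 : ∀ (ℓ : V →ₗ[ℝ] ℝ) (x : V) (L : V →ₗ[ℝ] V),
      LinearMap.trace ℝ V (L ∘ₗ ℓ.smulRight x) = ℓ (L x) := fun ℓ x L => by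
    rw [show L ∘ₗ ℓ.smulRight x = ℓ.smulRight (L x) from LinearMap.ext fun u => by simp]
    exact LinearMap.trace_smulRight ℓ (L x)
  have h3 : LinearMap.trace ℝ V ((∑ k, a k v • P k) ∘ₗ ∑ k, a k w • P k) =
      ∑ k, m k * (a k v * a k w) := by
    have h : (∑ k, a k v • P k) ∘ₗ ∑ k, a k w • P k = ∑ k, (a k v * a k w) • P k := by
      ext u
      have hu : ∀ k l, P k (P l u) = if k = l then P k u else 0 := fun k l => by
        rw [← LinearMap.comp_apply, hP]
        split_ifs <;> rfl
      simp [LinearMap.sum_apply, map_sum, hu, smul_smul]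
    simp only [h, map_sum, map_smul, smul_eq_mul, hm]
    exact Finset.sum_congr rfl fun k _ => by ring
  have h4 : ∀ x y : V, (∀ k, P k x = if k = i then x else 0) →
      (∑ k, a k y • P k) x = a i y • x := fun x y hx => by
    simp [LinearMap.sum_apply, hx]
  have h5 : ∀ x y : V, (∀ k, b i x (P k (N i)) = if k = i then a i x else 0) →
      b i x ((∑ k, a k y • P k) (N i)) = a i y * a i x := fun x y hx => by
    simp [LinearMap.sum_apply, hx]
  rw [shape_of_mem_block hv hbv, shape_of_mem_block hw hbw]
  simp only [LinearMap.comp_add, LinearMap.comp_sub, LinearMap.add_comp, LinearMap.sub_comp,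
    map_add, map_sub, h3]
  simp only [h1, h2, h4 w v hw, h4 v w hv, h5 v w hNv, h5 w v hNw, LinearMap.smulRight_apply,
    map_smul, smul_eq_mul, hNv', hNw', hsymm]
  ring

end Shape

/-! ### Traces on a product space -/

section TracePi

variable {ι : Type*} [Fintype ι] [DecidableEq ι] {E : ι → Type*} [∀ i, AddCommGroup (E i)]
  [∀ i, Module ℝ (E i)] [∀ i, FiniteDimensional ℝ (E i)]

theorem trace_single_comp_comp_proj (i : ι) (L : E i →ₗ[ℝ] E i) :
    LinearMap.trace ℝ (∀ i, E i) (LinearMap.single ℝ E i ∘ₗ L ∘ₗ LinearMap.proj i) =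
      LinearMap.trace ℝ (E i) L := by
  rw [LinearMap.trace_comp_comm', LinearMap.comp_assoc, LinearMap.proj_comp_single_same,
    LinearMap.comp_id]

theorem trace_pi_eq_sum (L : (∀ i, E i) →ₗ[ℝ] ∀ i, E i) :
    LinearMap.trace ℝ (∀ i, E i) L =
      ∑ i, LinearMap.trace ℝ (E i) (LinearMap.proj i ∘ₗ L ∘ₗ LinearMap.single ℝ E i) := by
  have h : L = ∑ i, LinearMap.single ℝ E i ∘ₗ (LinearMap.proj i ∘ₗ L) := by
    ext1 i
    ext1 x
    ext j
    simp [Finset.sum_apply]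
  conv_lhs => rw [h]
  rw [map_sum]
  refine Finset.sum_congr rfl fun i _ => ?_
  rw [LinearMap.trace_comp_comm', LinearMap.comp_assoc]

end TracePi

end Multiconformal

namespace Multiconformal

open Filter Topology

/-! ### The Levi-Civita connection of a multiconformal metric -/

section CoordinateProduct

variable {ι : Type*} [Fintype ι] {E : ι → Type*} [∀ i, NormedAddCommGroup (E i)]
  [∀ i, NormedSpace ℝ (E i)]

/-- The metric `∑ i, exp (2 φ_i) π_i^* G_i` in coordinates. -/
def multiMetric (G : ∀ i, E i → E i →L[ℝ] E i →L[ℝ] ℝ) (φ : ι → (∀ i, E i) → ℝ) (y : ∀ i, E i) :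
    (∀ i, E i) →L[ℝ] (∀ i, E i) →L[ℝ] ℝ :=
  ∑ i, Real.exp (2 * φ i y) • pullback (ContinuousLinearMap.proj i) (G i (y i))

variable {G : ∀ i, E i → E i →L[ℝ] E i →L[ℝ] ℝ} {φ : ι → (∀ i, E i) → ℝ} {y : ∀ i, E i}

theorem multiMetric_apply (v w : ∀ i, E i) :
    multiMetric G φ y v w = ∑ i, Real.exp (2 * φ i y) * G i (y i) (v i) (w i) := by
  simp [multiMetric, sum_apply, smul_apply, pullback_apply]

theorem contDiffAt_multiMetric (hG : ∀ i, IsMetricAt (G i) (y i))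
    (hφ : ∀ i, ContDiffAt ℝ 2 (φ i) y) : ContDiffAt ℝ 2 (multiMetric G φ) y := by
  unfold multiMetric
  refine ContDiffAt.sum fun i _ => ContDiffAt.fun_smul ?_ ?_
  · exact (contDiffAt_const.mul (hφ i)).exp
  · have h : ContDiffAt ℝ 2 (fun z : ∀ i, E i => G i (z i)) y :=
      (hG i).contDiffAt.comp y (ContinuousLinearMap.proj (R := ℝ) (φ := E) i).contDiff.contDiffAt
    unfold pullback
    exact contDiffAt_const.clm_comp (h.clm_comp contDiffAt_const)

theorem fderiv_multiMetric (hG : ∀ i, DifferentiableAt ℝ (G i) (y i))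
    (hφ : ∀ i, DifferentiableAt ℝ (φ i) y)
    (hd : DifferentiableAt ℝ (multiMetric G φ) y)
    (u v w : ∀ i, E i) :
    fderiv ℝ (multiMetric G φ) y u v w = ∑ i, Real.exp (2 * φ i y) *
      (2 * fderiv ℝ (φ i) y u * G i (y i) (v i) (w i) +
        fderiv ℝ (G i) (y i) (u i) (v i) (w i)) := by
  have h1 := hasFDerivAt_metric_apply hd v w
  have h2 : HasFDerivAt (fun z => multiMetric G φ z v w)
      (∑ i, (Real.exp (2 * φ i y) •
        ((ContinuousLinearMap.apply ℝ ℝ (w i)).comp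
          ((ContinuousLinearMap.apply ℝ (E i →L[ℝ] ℝ) (v i)).comp (fderiv ℝ (G i) (y i)))).comp
            (ContinuousLinearMap.proj i) +
        (G i (y i) (v i) (w i)) • Real.exp (2 * φ i y) • (2 : ℝ) • fderiv ℝ (φ i) y)) y := by
    simp only [multiMetric_apply]
    refine HasFDerivAt.fun_sum fun i _ => HasFDerivAt.mul ?_ ?_
    · exact ((hφ i).hasFDerivAt.const_mul 2).exp
    · exact (hasFDerivAt_metric_apply (hG i) (v i) (w i)).comp y
        (ContinuousLinearMap.proj (R := ℝ) (φ := E) i).hasFDerivAt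
  have h3 := DFunLike.congr_fun (h1.unique h2) u
  simp only [ContinuousLinearMap.comp_apply, ContinuousLinearMap.apply_apply, sum_apply,
    add_apply, smul_apply, smul_eq_mul, ContinuousLinearMap.proj_apply] at h3
  rw [h3]
  exact Finset.sum_congr rfl fun i _ => by ring

variable [DecidableEq ι]

/-- The `G_j`-gradient of `φ_k` in the direction of the `j`-th factor. -/
def partialGrad (G : ∀ i, E i → E i →L[ℝ] E i →L[ℝ] ℝ) (φ : ι → (∀ i, E i) → ℝ) (j k : ι)
    (y : ∀ i, E i) : E j :=
  (G j (y j)).inverse ((fderiv ℝ (φ k) y).comp (ContinuousLinearMap.single ℝ E j))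

theorem apply_partialGrad {j : ι} (hG : (G j (y j)).IsInvertible) (k : ι) (w : E j) :
    G j (y j) (partialGrad G φ j k y) w = fderiv ℝ (φ k) y (Pi.single j w) := by
  rw [partialGrad, hG.self_apply_inverse]
  rfl

/-- The inverse of `multiMetric G φ y`. -/
def multiInverse (G : ∀ i, E i → E i →L[ℝ] E i →L[ℝ] ℝ) (φ : ι → (∀ i, E i) → ℝ) (y : ∀ i, E i) :
    ((∀ i, E i) →L[ℝ] ℝ) →L[ℝ] (∀ i, E i) :=
  ContinuousLinearMap.pi fun j => Real.exp (-(2 * φ j y)) •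
    ((G j (y j)).inverse.comp ((ContinuousLinearMap.single ℝ E j).precomp ℝ))

theorem multiInverse_apply (ℓ : (∀ i, E i) →L[ℝ] ℝ) (j : ι) :
    multiInverse G φ y ℓ j = Real.exp (-(2 * φ j y)) •
      (G j (y j)).inverse (ℓ.comp (ContinuousLinearMap.single ℝ E j)) := rfl

theorem multiMetric_comp_multiInverse (hG : ∀ i, (G i (y i)).IsInvertible) :
    (multiMetric G φ y).comp (multiInverse G φ y) = .id ℝ _ := by
  refine ContinuousLinearMap.ext fun ℓ => ContinuousLinearMap.ext fun w => ?_
  simp only [ContinuousLinearMap.comp_apply, multiMetric_apply, multiInverse_apply, map_smul,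
    (hG _).self_apply_inverse, smul_apply, smul_eq_mul, ContinuousLinearMap.id_apply]
  rw [← ContinuousLinearMap.sum_comp_single]
  simp only [← mul_assoc, ← Real.exp_add, add_neg_cancel, Real.exp_zero, one_mul]
  rfl

theorem multiInverse_comp_multiMetric (hG : ∀ i, (G i (y i)).IsInvertible) :
    (multiInverse G φ y).comp (multiMetric G φ y) = .id ℝ _ := by
  refine ContinuousLinearMap.ext fun v => funext fun j => ?_
  have h : (multiMetric G φ y v).comp (ContinuousLinearMap.single ℝ E j) =
      Real.exp (2 * φ j y) • G j (y j) (v j) := by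
    refine ContinuousLinearMap.ext fun w => ?_
    simp only [ContinuousLinearMap.comp_apply, multiMetric_apply, smul_apply, smul_eq_mul]
    rw [Finset.sum_eq_single j]
    · simp
    · intro i _ hi
      simp [hi]
    · simp
  simp only [ContinuousLinearMap.comp_apply, multiInverse_apply, h, map_smul,
    (hG _).inverse_apply_self, smul_smul, ← Real.exp_add, neg_add_cancel, Real.exp_zero, one_smul,
    ContinuousLinearMap.id_apply]

theorem isInvertible_multiMetric (hG : ∀ i, (G i (y i)).IsInvertible) :
    (multiMetric G φ y).IsInvertible :=
  .of_inverse (multiMetric_comp_multiInverse hG) (multiInverse_comp_multiMetric hG)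

theorem inverse_multiMetric (hG : ∀ i, (G i (y i)).IsInvertible) :
    (multiMetric G φ y).inverse = multiInverse G φ y :=
  ContinuousLinearMap.inverse_eq (multiMetric_comp_multiInverse hG)
    (multiInverse_comp_multiMetric hG)

theorem IsMetricAt.multiMetric (hG : ∀ i, IsMetricAt (G i) (y i))
    (hφ : ∀ i, ContDiffAt ℝ 2 (φ i) y) : IsMetricAt (multiMetric G φ) y where
  contDiffAt := contDiffAt_multiMetric hG hφ
  symm := by
    have h : ∀ i, ∀ᶠ z in 𝓝 y, ∀ v w, G i (z i) v w = G i (z i) w v := fun i =>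
      (continuous_apply i).continuousAt.eventually (hG i).symm
    filter_upwards [eventually_all.2 h] with z hz v w
    simp only [multiMetric_apply, hz]
  isInvertible := isInvertible_multiMetric fun i => (hG i).isInvertible

/-- The projection of `∀ i, E i` onto its `k`-th factor. -/
def blockProj (E : ι → Type*) [∀ i, NormedAddCommGroup (E i)] [∀ i, NormedSpace ℝ (E i)] (k : ι) :
    (∀ i, E i) →ₗ[ℝ] ∀ i, E i :=
  LinearMap.single ℝ E k ∘ₗ LinearMap.proj k

theorem blockProj_apply (k : ι) (v : ∀ i, E i) : blockProj E k v = Pi.single k (v k) := rfl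

/-- The bilinear form `π_k^* G_k`. -/
def blockForm (G : ∀ i, E i → E i →L[ℝ] E i →L[ℝ] ℝ) (y : ∀ i, E i) (k : ι) :
    (∀ i, E i) →ₗ[ℝ] (∀ i, E i) →ₗ[ℝ] ℝ where
  toFun v := (G k (y k) (v k) : E k →ₗ[ℝ] ℝ) ∘ₗ LinearMap.proj k
  map_add' u v := by ext; simp
  map_smul' c v := by ext; simp

theorem blockForm_apply (k : ι) (v w : ∀ i, E i) :
    blockForm G y k v w = G k (y k) (v k) (w k) := rfl

/-- The vector `exp (2 φ_k) grad φ_k`, with the gradient taken in the metric `multiMetric G φ`. -/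
def warpGrad (G : ∀ i, E i → E i →L[ℝ] E i →L[ℝ] ℝ) (φ : ι → (∀ i, E i) → ℝ) (y : ∀ i, E i)
    (k : ι) : ∀ i, E i :=
  fun j => Real.exp (2 * φ k y - 2 * φ j y) • partialGrad G φ j k y

/-- The difference of the Levi-Civita connections of `multiMetric G φ` and of the product
metric. -/
def warpTensor (G : ∀ i, E i → E i →L[ℝ] E i →L[ℝ] ℝ) (φ : ι → (∀ i, E i) → ℝ) (y : ∀ i, E i) :
    (∀ i, E i) → (∀ i, E i) →ₗ[ℝ] ∀ i, E i :=
  shape (fun k => (fderiv ℝ (φ k) y : (∀ i, E i) →ₗ[ℝ] ℝ)) (blockProj E) (blockForm G y)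
    (warpGrad G φ y)

theorem warpTensor_apply (v w : ∀ i, E i) :
    warpTensor G φ y v w = ∑ k, (fderiv ℝ (φ k) y v • (Pi.single k (w k) : ∀ i, E i) +
      fderiv ℝ (φ k) y w • (Pi.single k (v k) : ∀ i, E i) -
      G k (y k) (v k) (w k) • warpGrad G φ y k) := by
  rw [warpTensor, shape_apply]
  rfl

theorem warpTensor_apply_apply (v w : ∀ i, E i) (j : ι) :
    warpTensor G φ y v w j = fderiv ℝ (φ j) y v • w j + fderiv ℝ (φ j) y w • v j -
      ∑ k, G k (y k) (v k) (w k) • warpGrad G φ y k j := by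
  rw [warpTensor_apply]
  simp only [Finset.sum_apply, Pi.sub_apply, Pi.add_apply, Pi.smul_apply,
    Finset.sum_sub_distrib, Finset.sum_add_distrib]
  congr 2
  · rw [Finset.sum_eq_single j]
    · simp
    · intro k _ hk
      simp [hk.symm]
    · simp
  · rw [Finset.sum_eq_single j]
    · simp
    · intro k _ hk
      simp [hk.symm]
    · simp

/-- Differentiating the weights `exp (2 φ_k)` adds three terms per factor to the Koszul expression.
The two along `u` and `v` become the projection terms of the tensor; the one along `w` is raised to
the gradient `warpGrad`. -/
theorem christoffel_multiMetric (hG : ∀ i, IsMetricAt (G i) (y i))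
    (hφ : ∀ i, ContDiffAt ℝ 2 (φ i) y) (u v : ∀ i, E i) :
    christoffel (Multiconformal.multiMetric G φ) y u v =
      (fun j => christoffel (G j) (y j) (u j) (v j)) + warpTensor G φ y u v := by
  have hM := IsMetricAt.multiMetric hG hφ
  have hinv := fun i => (hG i).isInvertible
  have hdG := fun i => (hG i).differentiableAt
  have hdφ := fun i => (hφ i).differentiableAt (by norm_num)
  refine christoffel_eq_of_forall hM.isInvertible fun w => ?_
  have h1 : ∀ j, G j (y j) (christoffel (G j) (y j) (u j) (v j)) (w j) =
      1 / 2 * koszul (G j) (y j) (u j) (v j) (w j) := fun j => apply_christoffel (hinv j) _ _ _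
  have h2 : ∀ k, fderiv ℝ (φ k) y w = ∑ j, fderiv ℝ (φ k) y (Pi.single j (w j)) := fun k => by
    rw [← map_sum, Finset.univ_sum_single]
  -- `warpGrad G φ y k` is the full-metric gradient of `φ k` scaled by `exp (2 φ_k)`: the weight of
  -- each factor `j` cancels and the partial differentials sum to the whole one.
  have h3 : ∑ j, Real.exp (2 * φ j y) *
      G j (y j) (∑ k, G k (y k) (u k) (v k) • warpGrad G φ y k j) (w j) =
      ∑ k, Real.exp (2 * φ k y) * (fderiv ℝ (φ k) y w * G k (y k) (u k) (v k)) := by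
    simp only [map_sum, sum_apply, map_smul, smul_apply, warpGrad, h2, apply_partialGrad (hinv _),
      Finset.mul_sum, Finset.sum_mul, smul_eq_mul]
    rw [Finset.sum_comm]
    refine Finset.sum_congr rfl fun k _ => Finset.sum_congr rfl fun j _ => ?_
    rw [Real.exp_sub]
    field_simp
  rw [koszul_apply]
  simp only [fderiv_multiMetric hdG hdφ hM.differentiableAt]
  rw [multiMetric_apply]
  simp only [Pi.add_apply, warpTensor_apply_apply, map_add, map_sub, map_smul, add_apply,
    sub_apply, smul_apply, h1, mul_add, mul_sub, Finset.sum_add_distrib, Finset.sum_sub_distrib, h3,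
    koszul_apply, smul_eq_mul]
  simp only [Finset.mul_sum, ← Finset.sum_add_distrib, ← Finset.sum_sub_distrib]
  refine Finset.sum_congr rfl fun i _ => ?_
  ring

end CoordinateProduct

end Multiconformal

namespace Multiconformal

open Filter Topology

/-! ### Curvature in terms of the connection difference -/

section CoordinateCurvature

variable {ι : Type*} [Fintype ι] [DecidableEq ι] {E : ι → Type*} [∀ i, NormedAddCommGroup (E i)]
  [∀ i, NormedSpace ℝ (E i)]
  {G : ∀ i, E i → E i →L[ℝ] E i →L[ℝ] ℝ} {φ : ι → (∀ i, E i) → ℝ} {y : ∀ i, E i}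

theorem warpTensor_symm (hG : ∀ i, IsMetricAt (G i) (y i)) (v w : ∀ i, E i) :
    warpTensor G φ y v w = warpTensor G φ y w v :=
  shape_symm (fun k v w => (hG k).symm.self_of_nhds (v k) (w k)) v w

/-- The direct product metric in coordinates. -/
abbrev directMetric (G : ∀ i, E i → E i →L[ℝ] E i →L[ℝ] ℝ) :
    (∀ i, E i) → (∀ i, E i) →L[ℝ] (∀ i, E i) →L[ℝ] ℝ :=
  multiMetric G fun _ _ => 0

theorem IsMetricAt.directMetric (hG : ∀ i, IsMetricAt (G i) (y i)) :
    IsMetricAt (directMetric G) y :=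
  .multiMetric hG fun _ => contDiffAt_const

theorem christoffel_directMetric (hG : ∀ i, IsMetricAt (G i) (y i)) (u v : ∀ i, E i) :
    christoffel (directMetric G) y u v = fun j => christoffel (G j) (y j) (u j) (v j) := by
  rw [christoffel_multiMetric hG fun _ => contDiffAt_const, add_eq_left]
  ext j
  simp [warpTensor_apply_apply, warpGrad, partialGrad]

theorem christoffel_multiMetric_eq_add (hG : ∀ i, IsMetricAt (G i) (y i))
    (hφ : ∀ i, ContDiffAt ℝ 2 (φ i) y) (u v : ∀ i, E i) :
    christoffel (multiMetric G φ) y u v =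
      christoffel (directMetric G) y u v + warpTensor G φ y u v := by
  rw [christoffel_multiMetric hG hφ, christoffel_directMetric hG]

/-- The covariant derivative of `warpGrad G φ y k` for the connection of the product metric. -/
def warpHess (G : ∀ i, E i → E i →L[ℝ] E i →L[ℝ] ℝ) (φ : ι → (∀ i, E i) → ℝ) (y : ∀ i, E i)
    (k : ι) : (∀ i, E i) →ₗ[ℝ] ∀ i, E i :=
  LinearMap.pi fun j => Real.exp (2 * φ k y - 2 * φ j y) •
    (((2 : ℝ) • (fderiv ℝ (φ k) y - fderiv ℝ (φ j) y)).smulRight (partialGrad G φ j k y) +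
      (G j (y j)).inverse.comp (((ContinuousLinearMap.single ℝ E j).precomp ℝ).comp
        (hessian (directMetric G) (φ k) y)) : (∀ i, E i) →L[ℝ] E j)

theorem warpHess_apply (k : ι) (u : ∀ i, E i) (j : ι) :
    warpHess G φ y k u j = Real.exp (2 * φ k y - 2 * φ j y) •
      ((2 * (fderiv ℝ (φ k) y u - fderiv ℝ (φ j) y u)) • partialGrad G φ j k y +
      (G j (y j)).inverse ((hessian (directMetric G) (φ k) y u).comp
        (ContinuousLinearMap.single ℝ E j))) := by
  simp [warpHess]

/-- The curve `t ↦ y + t u` has velocity `u`. -/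
theorem hasDerivAt_line {F : Type*} [NormedAddCommGroup F] [NormedSpace ℝ F] (z u : F) :
    HasDerivAt (fun t : ℝ => z + t • u) u 0 := by
  simpa using ((hasDerivAt_id (0 : ℝ)).smul_const u).const_add z

theorem hasDerivAt_comp_line {F F' : Type*} [NormedAddCommGroup F] [NormedSpace ℝ F]
    [NormedAddCommGroup F'] [NormedSpace ℝ F'] {f : F → F'} {z : F} (hf : DifferentiableAt ℝ f z)
    (u : F) : HasDerivAt (fun t : ℝ => f (z + t • u)) (fderiv ℝ f z u) 0 := by
  have h : HasFDerivAt f (fderiv ℝ f z) (z + (0 : ℝ) • u) := by simpa using hf.hasFDerivAt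
  exact h.comp_hasDerivAt 0 (hasDerivAt_line z u)

theorem eventually_line {F : Type*} [NormedAddCommGroup F] [NormedSpace ℝ F] {p : F → Prop} {z : F}
    (h : ∀ᶠ x in 𝓝 z, p x) (u : F) : ∀ᶠ t : ℝ in 𝓝 0, p (z + t • u) := by
  have hc := (hasDerivAt_line z u).continuousAt
  have h0 : Tendsto (fun t : ℝ => z + t • u) (𝓝 0) (𝓝 z) := by
    simpa [ContinuousAt] using hc
  exact h0.eventually h

theorem hasDerivAt_metric_line {F : Type*} [NormedAddCommGroup F] [NormedSpace ℝ F]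
    {g : F → F →L[ℝ] F →L[ℝ] ℝ} {z : F} (hg : DifferentiableAt ℝ g z) {a b : ℝ → F} {a' b' : F}
    (ha : HasDerivAt a a' 0) (hb : HasDerivAt b b' 0) (u : F) :
    HasDerivAt (fun t : ℝ => g (z + t • u) (a t) (b t))
      (fderiv ℝ g z u (a 0) (b 0) + g z a' (b 0) + g z (a 0) b') 0 := by
  simpa using ((hasDerivAt_comp_line hg u).clm_apply ha).clm_apply hb

variable [∀ i, FiniteDimensional ℝ (E i)]

/-- Differentiate the defining identity `G_j (grad, w) = dφ_k (w)` along `u` and use `∇G_j = 0`: the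
covariant derivative of the gradient is the Hessian with one index raised. -/
theorem hasDerivAt_partialGrad (hG : ∀ i, IsMetricAt (G i) (y i))
    (hφ : ∀ i, ContDiffAt ℝ 2 (φ i) y) (j k : ι) (u : ∀ i, E i) :
    HasDerivAt (fun t : ℝ => partialGrad G φ j k (y + t • u))
      ((G j (y j)).inverse ((hessian (directMetric G) (φ k) y u).comp
        (ContinuousLinearMap.single ℝ E j)) -
        christoffel (G j) (y j) (u j) (partialGrad G φ j k y)) 0 := by
  have hd : DifferentiableAt ℝ (fderiv ℝ (φ k)) y :=
    ((hφ k).fderiv_right (m := 1) (by norm_num)).differentiableAt (by norm_num)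
  have hdn : DifferentiableAt ℝ (partialGrad G φ j k) y := by
    unfold partialGrad
    refine DifferentiableAt.clm_apply ?_ (hd.clm_comp (differentiableAt_const _))
    exact (hG j).differentiableAt_inverse.comp y
      (ContinuousLinearMap.proj (R := ℝ) (φ := E) j).differentiableAt
  have h1 := hasDerivAt_comp_line hdn u
  convert h1 using 1
  apply (hG j).isInvertible.injective
  ext w
  have h2 := hasDerivAt_metric_line (hG j).differentiableAt h1 (hasDerivAt_const 0 w) (u j)
  have h3 := (hasDerivAt_comp_line hd u).clm_apply
    (hasDerivAt_const 0 (Pi.single j w : ∀ i, E i))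
  have h4 : (fun t : ℝ => G j (y j + t • u j) (partialGrad G φ j k (y + t • u)) w) =ᶠ[𝓝 0]
      fun t : ℝ => fderiv ℝ (φ k) (y + t • u) (Pi.single j w) := by
    have h5 : ∀ᶠ z in 𝓝 y, (G j (z j)).IsInvertible :=
      (continuous_apply j).continuousAt.eventually
        ((hG j).eventually.mono fun z hz => hz.isInvertible)
    filter_upwards [eventually_line h5 u] with t ht
    exact apply_partialGrad (y := y + t • u) ht k w
  have h6 := h2.unique (h3.congr_of_eventuallyEq h4)
  simp only [zero_smul, add_zero, map_zero, (hG j).fderiv_eq] at h6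
  have h7 : christoffel (directMetric G) y u (Pi.single j w) =
      Pi.single j (christoffel (G j) (y j) (u j) w) := by
    rw [christoffel_directMetric hG]
    ext i
    rcases eq_or_ne i j with rfl | hi
    · simp
    · simp [hi]
  rw [map_sub, sub_apply, (hG j).isInvertible.self_apply_inverse]
  simp only [ContinuousLinearMap.comp_apply, ContinuousLinearMap.single_apply, hessian_apply, h7]
  rw [← apply_partialGrad (hG j).isInvertible]
  linarith

/-- Besides the Hessian, the weight `exp (2 φ_k - 2 φ_j)` contributes `2 (dφ_k - dφ_j)(u)`, the
rank-one part of `warpHess`. -/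
theorem hasDerivAt_warpGrad (hG : ∀ i, IsMetricAt (G i) (y i))
    (hφ : ∀ i, ContDiffAt ℝ 2 (φ i) y) (k : ι) (u : ∀ i, E i) :
    HasDerivAt (fun t : ℝ => warpGrad G φ (y + t • u) k)
      (warpHess G φ y k u - christoffel (directMetric G) y u (warpGrad G φ y k)) 0 := by
  rw [hasDerivAt_pi]
  intro j
  have h1 := hasDerivAt_comp_line ((hφ k).differentiableAt (by norm_num)) u
  have h2 := hasDerivAt_comp_line ((hφ j).differentiableAt (by norm_num)) u
  have h3 := ((h1.const_mul 2).fun_sub (h2.const_mul 2)).exp.fun_smul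
    (hasDerivAt_partialGrad hG hφ j k u)
  refine h3.congr_deriv ?_
  simp only [christoffel_directMetric hG, Pi.sub_apply, warpHess_apply, warpGrad, map_smul,
    zero_smul, add_zero]
  module

/-- The block projections and block forms are parallel for the product connection, so the covariant
derivative of the difference tensor falls only on the differentials and gradients of the `φ_k`. The
last three terms convert covariant into coordinate derivatives. -/
theorem fderiv_christoffel_multiMetric (hG : ∀ i, IsMetricAt (G i) (y i))
    (hφ : ∀ i, ContDiffAt ℝ 2 (φ i) y) (u v w : ∀ i, E i) :
    fderiv ℝ (christoffel (multiMetric G φ)) y u v w =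
      (fun j => fderiv ℝ (christoffel (G j)) (y j) (u j) (v j) (w j)) +
      ∑ k, (hessian (directMetric G) (φ k) y u v • blockProj E k w +
        hessian (directMetric G) (φ k) y u w • blockProj E k v -
        blockForm G y k v w • warpHess G φ y k u) -
      christoffel (directMetric G) y u (warpTensor G φ y v w) +
      warpTensor G φ y w (christoffel (directMetric G) y u v) +
      warpTensor G φ y v (christoffel (directMetric G) y u w) := by
  have h1 := ((hasDerivAt_comp_line
    (IsMetricAt.multiMetric hG hφ).differentiableAt_christoffel u).clm_apply
      (hasDerivAt_const 0 v)).clm_apply (hasDerivAt_const 0 w)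
  have h2 : (fun t : ℝ => christoffel (multiMetric G φ) (y + t • u) v w) =ᶠ[𝓝 0] fun t =>
      (fun j => christoffel (G j) (y j + t • u j) (v j) (w j)) +
        warpTensor G φ (y + t • u) v w := by
    have h3 : ∀ᶠ z in 𝓝 y, ∀ i, IsMetricAt (G i) (z i) := eventually_all.2 fun i =>
      (continuous_apply i).continuousAt.eventually (hG i).eventually
    have h4 : ∀ᶠ z in 𝓝 y, ∀ i, ContDiffAt ℝ 2 (φ i) z := eventually_all.2 fun i =>
      (hφ i).eventually (by norm_num)
    filter_upwards [eventually_line (h3.and h4) u] with t ht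
    exact christoffel_multiMetric ht.1 ht.2 v w
  have h5 : HasDerivAt (fun t : ℝ => (fun j => christoffel (G j) (y j + t • u j) (v j) (w j) :
      ∀ i, E i)) (fun j => fderiv ℝ (christoffel (G j)) (y j) (u j) (v j) (w j)) 0 := by
    rw [hasDerivAt_pi]
    intro j
    simpa using ((hasDerivAt_comp_line (hG j).differentiableAt_christoffel (u j)).clm_apply
      (hasDerivAt_const 0 (v j))).clm_apply (hasDerivAt_const 0 (w j))
  have h6 : ∀ k (x : ∀ i, E i), HasDerivAt (fun t : ℝ => fderiv ℝ (φ k) (y + t • u) x)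
      (fderiv ℝ (fderiv ℝ (φ k)) y u x) 0 := fun k x => by
    have hd : DifferentiableAt ℝ (fderiv ℝ (φ k)) y :=
      ((hφ k).fderiv_right (m := 1) (by norm_num)).differentiableAt (by norm_num)
    simpa using (hasDerivAt_comp_line hd u).clm_apply (hasDerivAt_const 0 x)
  have h7 : HasDerivAt (fun t : ℝ => warpTensor G φ (y + t • u) v w)
      (∑ k, (fderiv ℝ (fderiv ℝ (φ k)) y u v • blockProj E k w +
        fderiv ℝ (fderiv ℝ (φ k)) y u w • blockProj E k v -
        (G k (y k) (v k) (w k) • (warpHess G φ y k u -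
          christoffel (directMetric G) y u (warpGrad G φ y k)) +
        fderiv ℝ (G k) (y k) (u k) (v k) (w k) • warpGrad G φ y k))) 0 := by
    simp only [warpTensor_apply]
    refine HasDerivAt.fun_sum fun k _ => ((h6 k v).smul_const _).fun_add
      ((h6 k w).smul_const _) |>.fun_sub ?_
    have h8 := (hasDerivAt_metric_line (hG k).differentiableAt (hasDerivAt_const 0 (v k))
      (hasDerivAt_const 0 (w k)) (u k)).fun_smul (hasDerivAt_warpGrad hG hφ k u)
    simpa using h8
  have h9 := h1.unique ((h5.fun_add h7).congr_of_eventuallyEq h2)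
  simp only [zero_smul, add_zero, map_zero] at h9
  rw [h9]
  simp only [add_assoc, sub_eq_add_neg]
  congr 1
  simp only [warpTensor_apply, map_sum, ← Finset.sum_neg_distrib, ← Finset.sum_add_distrib]
  refine Finset.sum_congr rfl fun k _ => ?_
  -- The product connection preserves each factor: the projections are parallel.
  have h10 : ∀ x : ∀ i, E i, christoffel (directMetric G) y u (Pi.single k (x k)) =
      Pi.single k (christoffel (directMetric G) y u x k) := fun x => by
    simp only [christoffel_directMetric hG]
    ext i
    rcases eq_or_ne i k with rfl | hi
    · simp
    · simp [hi]
  simp only [map_sub, map_add, map_smul, h10, hessian_apply, blockProj_apply, blockForm_apply,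
    (hG k).fderiv_eq]
  rw [(hG k).symm.self_of_nhds (w k)]
  simp only [christoffel_directMetric hG]
  module

/-- The general rule `R̃(u,v)w = R(u,v)w + (∇_u S)(v,w) - (∇_v S)(u,w) + S(u,S(v,w)) - S(v,S(u,w))`
for connections differing by `S`. Mixed terms in `S` and the Christoffel symbols cancel because the
product connection is torsion free. -/
theorem curvature_multiMetric (hG : ∀ i, IsMetricAt (G i) (y i))
    (hφ : ∀ i, ContDiffAt ℝ 2 (φ i) y) (u v w : ∀ i, E i) :
    curvature (multiMetric G φ) y v w u =
      (fun j => curvature (G j) (y j) (v j) (w j) (u j)) +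
      ∑ k, (hessian (directMetric G) (φ k) y u v • blockProj E k w +
        hessian (directMetric G) (φ k) y u w • blockProj E k v -
        blockForm G y k v w • warpHess G φ y k u) -
      ∑ k, (hessian (directMetric G) (φ k) y v u • blockProj E k w +
        hessian (directMetric G) (φ k) y v w • blockProj E k u -
        blockForm G y k u w • warpHess G φ y k v) +
      warpTensor G φ y u (warpTensor G φ y v w) - warpTensor G φ y v (warpTensor G φ y u w) := by
  have h0 : (fun j => curvature (G j) (y j) (v j) (w j) (u j)) =
      (fun j => fderiv ℝ (christoffel (G j)) (y j) (u j) (v j) (w j)) -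
      (fun j => fderiv ℝ (christoffel (G j)) (y j) (v j) (u j) (w j)) +
      christoffel (directMetric G) y u (christoffel (directMetric G) y v w) -
      christoffel (directMetric G) y v (christoffel (directMetric G) y u w) := by
    simp only [christoffel_directMetric hG]
    rfl
  rw [h0]
  simp only [curvature, LinearMap.coe_mk, AddHom.coe_mk]
  rw [fderiv_christoffel_multiMetric hG hφ, fderiv_christoffel_multiMetric hG hφ]
  simp only [christoffel_multiMetric_eq_add hG hφ, map_add]
  rw [(IsMetricAt.directMetric hG).christoffel_symm v u]
  abel

end CoordinateCurvature

end Multiconformal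

namespace Multiconformal

/-! ### Ricci and scalar curvature of a multiconformal metric -/

section CoordinateScalar

variable {ι : Type*} [Fintype ι] [DecidableEq ι] {E : ι → Type*} [∀ i, NormedAddCommGroup (E i)]
  [∀ i, NormedSpace ℝ (E i)]

/-- The `G_j`-scalar product of the `j`-th partial differentials of `φ_k` and `φ_l`. -/
def partialInner (G : ∀ i, E i → E i →L[ℝ] E i →L[ℝ] ℝ) (φ : ι → (∀ i, E i) → ℝ) (y : ∀ i, E i)
    (j k l : ι) : ℝ :=
  fderiv ℝ (φ k) y (Pi.single j (partialGrad G φ j l y))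

/-- The Laplacian of `φ_k` along the `j`-th factor. -/
def partialLaplacian (G : ∀ i, E i → E i →L[ℝ] E i →L[ℝ] ℝ) (φ : ι → (∀ i, E i) → ℝ)
    (y : ∀ i, E i) (j k : ι) : ℝ :=
  metricTrace (G j (y j))
    (pullback (ContinuousLinearMap.single ℝ E j) (hessian (directMetric G) (φ k) y))

variable {G : ∀ i, E i → E i →L[ℝ] E i →L[ℝ] ℝ} {φ : ι → (∀ i, E i) → ℝ} {y : ∀ i, E i}

theorem partialInner_symm (hG : ∀ i, IsMetricAt (G i) (y i)) (j k l : ι) :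
    partialInner G φ y j k l = partialInner G φ y j l k := by
  rw [partialInner, partialInner, ← apply_partialGrad (hG j).isInvertible,
    ← apply_partialGrad (hG j).isInvertible, (hG j).symm.self_of_nhds]

theorem fderiv_apply_warpGrad (i k : ι) :
    fderiv ℝ (φ k) y (warpGrad G φ y i) =
      ∑ j, Real.exp (2 * φ i y - 2 * φ j y) * partialInner G φ y j k i := by
  have h : fderiv ℝ (φ k) y (warpGrad G φ y i) =
      ∑ j, fderiv ℝ (φ k) y (Pi.single j (warpGrad G φ y i j)) := by
    rw [← map_sum, Finset.univ_sum_single]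
  rw [h]
  refine Finset.sum_congr rfl fun j _ => ?_
  rw [warpGrad, partialInner, Pi.single_smul, map_smul, smul_eq_mul]

theorem blockProj_single (k i : ι) (v : E i) :
    blockProj E k (Pi.single i v) = if k = i then Pi.single i v else 0 := by
  rw [blockProj_apply]
  split_ifs with h
  · subst h
    rw [Pi.single_eq_same]
  · rw [Pi.single_eq_of_ne h, Pi.single_zero]

theorem blockForm_single_of_ne {k i : ι} (h : k ≠ i) (v : E i) :
    blockForm G y k (Pi.single i v) = 0 := by
  refine LinearMap.ext fun u => ?_
  simp [blockForm_apply, Pi.single_eq_of_ne h]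

theorem blockForm_single_same (i : ι) (v : E i) (u : ∀ i, E i) :
    blockForm G y i (Pi.single i v) u = G i (y i) v (u i) := by
  rw [blockForm_apply, Pi.single_eq_same]

theorem blockProj_comp_blockProj (k l : ι) :
    blockProj E k ∘ₗ blockProj E l = if k = l then blockProj E k else 0 := by
  ext1 i
  ext1 x
  ext j
  split_ifs with h
  · subst h
    simp [blockProj_apply]
  · simp [blockProj_apply, h]

theorem warpGrad_self (i : ι) : warpGrad G φ y i i = partialGrad G φ i i y := by
  simp [warpGrad]

/-- This is the cancellation hypothesis of `trace_shape` for the difference tensor. -/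
theorem blockForm_warpGrad (hG : ∀ i, IsMetricAt (G i) (y i)) (k : ι) (z : ∀ i, E i) :
    blockForm G y k z (warpGrad G φ y k) = fderiv ℝ (φ k) y (Pi.single k (z k)) := by
  rw [blockForm_apply, warpGrad_self, (hG k).symm.self_of_nhds,
    apply_partialGrad (hG k).isInvertible]

variable [∀ i, FiniteDimensional ℝ (E i)]

theorem trace_blockProj (k : ι) :
    LinearMap.trace ℝ (∀ i, E i) (blockProj E k) = Module.finrank ℝ (E k) := by
  rw [← LinearMap.trace_id ℝ (E k), ← trace_single_comp_comp_proj k LinearMap.id]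
  rfl

theorem trace_warpHess (k : ι) :
    LinearMap.trace ℝ (∀ i, E i) (warpHess G φ y k) =
      ∑ j, Real.exp (2 * φ k y - 2 * φ j y) *
        (2 * (partialInner G φ y j k k - partialInner G φ y j j k) +
          partialLaplacian G φ y j k) := by
  rw [trace_pi_eq_sum]
  refine Finset.sum_congr rfl fun j _ => ?_
  have h : LinearMap.proj j ∘ₗ warpHess G φ y k ∘ₗ LinearMap.single ℝ E j =
      Real.exp (2 * φ k y - 2 * φ j y) •
        (((((2 : ℝ) • (fderiv ℝ (φ k) y - fderiv ℝ (φ j) y)).comp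
          (ContinuousLinearMap.single ℝ E j) : E j →L[ℝ] ℝ) : E j →ₗ[ℝ] ℝ).smulRight
            (partialGrad G φ j k y) +
        (((G j (y j)).inverse.comp (pullback (ContinuousLinearMap.single ℝ E j)
          (hessian (directMetric G) (φ k) y)) : E j →L[ℝ] E j) : E j →ₗ[ℝ] E j)) := by
    refine LinearMap.ext fun u => ?_
    simp only [LinearMap.comp_apply, LinearMap.proj_apply, warpHess_apply]
    rfl
  rw [h, map_smul, map_add, LinearMap.trace_smulRight]
  rfl

/-- Diagonal blocks suffice: the inverse metric is block diagonal, so the scalar curvature sees no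
others. With both vectors in block `i`, the curvature endomorphism is a sum of block, rank-one and
`shape` maps whose traces are known. -/
theorem ricci_multiMetric (hG : ∀ i, IsMetricAt (G i) (y i))
    (hφ : ∀ i, ContDiffAt ℝ 2 (φ i) y) (i : ι) (v w : E i) :
    ricci (multiMetric G φ) y (Pi.single i v) (Pi.single i w) =
      ricci (G i) (y i) v w +
      2 * hessian (directMetric G) (φ i) y (Pi.single i v) (Pi.single i w) -
      ∑ k, Module.finrank ℝ (E k) *
        hessian (directMetric G) (φ k) y (Pi.single i v) (Pi.single i w) -
      G i (y i) v w * LinearMap.trace ℝ (∀ i, E i) (warpHess G φ y i) +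
      ∑ k, Module.finrank ℝ (E k) *
        (fderiv ℝ (φ i) y (Pi.single i v) * fderiv ℝ (φ k) y (Pi.single i w) +
          fderiv ℝ (φ k) y (Pi.single i v) * fderiv ℝ (φ i) y (Pi.single i w) -
          G i (y i) v w * fderiv ℝ (φ k) y (warpGrad G φ y i)) -
      (∑ k, Module.finrank ℝ (E k) *
          (fderiv ℝ (φ k) y (Pi.single i v) * fderiv ℝ (φ k) y (Pi.single i w)) +
        2 * (fderiv ℝ (φ i) y (Pi.single i v) * fderiv ℝ (φ i) y (Pi.single i w)) -
        2 * (G i (y i) v w * fderiv ℝ (φ i) y (warpGrad G φ y i))) := by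
  set V : ∀ i, E i := Pi.single i v with hV
  set W : ∀ i, E i := Pi.single i w with hW
  set H := fun k => hessian (directMetric G) (φ k) y with hH
  have hsymm : ∀ k a b, H k a b = H k b a := fun k a b => by
    simp only [hH, hessian_apply]
    rw [(IsMetricAt.directMetric hG).christoffel_symm a b]
    congr 1
    exact ((hφ k).isSymmSndFDerivAt (by simp)).eq a b
  have hPV : ∀ k, blockProj E k V = if k = i then V else 0 := fun k => blockProj_single k i v
  have hPW : ∀ k, blockProj E k W = if k = i then W else 0 := fun k => blockProj_single k i w
  have hbV : ∀ k, k ≠ i → blockForm G y k V = 0 := fun k hk => blockForm_single_of_ne hk v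
  have hbW : ∀ k, k ≠ i → blockForm G y k W = 0 := fun k hk => blockForm_single_of_ne hk w
  have hVW : blockForm G y i V W = G i (y i) v w := by
    rw [blockForm_single_same, hW, Pi.single_eq_same]
  have hS : warpTensor G φ y V W = fderiv ℝ (φ i) y V • W + fderiv ℝ (φ i) y W • V -
      G i (y i) v w • warpGrad G φ y i := by
    rw [warpTensor, shape_of_mem_block hPV hbV, ← hVW]
    simp [LinearMap.sum_apply, hPW]
  have hNb : ∀ x : E i, blockForm G y i (Pi.single i x) (warpGrad G φ y i) =
      fderiv ℝ (φ i) y (Pi.single i x) := fun x => by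
    rw [blockForm_warpGrad hG, Pi.single_eq_same]
  have hNP : ∀ (x : E i) k, blockForm G y i (Pi.single i x) (blockProj E k (warpGrad G φ y i)) =
      if k = i then fderiv ℝ (φ i) y (Pi.single i x) else 0 := fun x k => by
    split_ifs with hk
    · subst hk
      rw [← hNb, blockForm_single_same, blockForm_single_same, blockProj_apply, Pi.single_eq_same]
    · rw [blockForm_single_same, blockProj_apply, Pi.single_eq_of_ne (Ne.symm hk), map_zero]
  -- In the diagonal block the weight is `1` and the rank-one part of `warpHess` vanishes.
  have hDN : blockForm G y i W (warpHess G φ y i V) = H i V W := by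
    rw [blockForm_single_same, warpHess_apply, (hG i).symm.self_of_nhds]
    simp only [sub_self, Real.exp_zero, mul_zero, zero_smul, zero_add, one_smul,
      (hG i).isInvertible.self_apply_inverse]
    rfl
  have hcurv : curvature (multiMetric G φ) y V W =
      LinearMap.single ℝ E i ∘ₗ curvature (G i) (y i) v w ∘ₗ LinearMap.proj i +
      ((H i).flip W : (∀ i, E i) →ₗ[ℝ] ℝ).smulRight V - G i (y i) v w • warpHess G φ y i -
      ∑ k, H k V W • blockProj E k + (blockForm G y i W).smulRight (warpHess G φ y i V) +
      warpTensor G φ y (warpTensor G φ y V W) - warpTensor G φ y V ∘ₗ warpTensor G φ y W := by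
    refine LinearMap.ext fun u => ?_
    rw [curvature_multiMetric hG hφ]
    have h1 : (fun j => curvature (G j) (y j) (V j) (W j) (u j)) =
        Pi.single i (curvature (G i) (y i) v w (u i)) := by
      ext j
      rcases eq_or_ne j i with rfl | hj
      · simp [hV, hW]
      · simp [hV, hW, hj, curvature]
    have h2 : ∑ k, (H k u V • blockProj E k W + H k u W • blockProj E k V -
        blockForm G y k V W • warpHess G φ y k u) =
        H i u V • W + H i u W • V - G i (y i) v w • warpHess G φ y i u := by
      rw [Finset.sum_eq_single i]
      · rw [hPV, hPW, if_pos rfl, if_pos rfl, hVW]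
      · intro k _ hk
        rw [hPV, hPW, if_neg hk, if_neg hk, hbV k hk]
        simp
      · simp
    have h3 : ∑ k, (H k V u • blockProj E k W + H k V W • blockProj E k u -
        blockForm G y k u W • warpHess G φ y k V) =
        H i V u • W + ∑ k, H k V W • blockProj E k u -
          blockForm G y i W u • warpHess G φ y i V := by
      rw [Finset.sum_sub_distrib, Finset.sum_add_distrib]
      congr 1
      · congr 1
        rw [Finset.sum_eq_single i]
        · rw [hPW, if_pos rfl]
        · intro k _ hk
          rw [hPW, if_neg hk, smul_zero]
        · simp
      · have h4 : ∀ k, blockForm G y k u W = blockForm G y k W u := fun k =>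
          (hG k).symm.self_of_nhds _ _
        simp only [h4]
        rw [Finset.sum_eq_single i]
        · intro k _ hk
          rw [hbW k hk]
          simp
        · simp
    rw [h1, h2, h3, hsymm i V u, warpTensor_symm hG u (warpTensor G φ y V W),
      warpTensor_symm hG u W]
    simp only [LinearMap.add_apply, LinearMap.sub_apply, LinearMap.comp_apply,
      LinearMap.smulRight_apply, LinearMap.smul_apply, LinearMap.sum_apply,
      LinearMap.proj_apply, LinearMap.single_apply, ContinuousLinearMap.coe_coe,
      ContinuousLinearMap.flip_apply]
    abel
  change LinearMap.trace ℝ _ (curvature (multiMetric G φ) y V W) = _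
  have hT3 : LinearMap.trace ℝ _ (warpTensor G φ y (warpTensor G φ y V W)) =
      ∑ k, (Module.finrank ℝ (E k) : ℝ) * fderiv ℝ (φ k) y (warpTensor G φ y V W) :=
    trace_shape (m := fun k => (Module.finrank ℝ (E k) : ℝ)) trace_blockProj
      fun k => (blockForm_warpGrad hG k _).symm
  have hT4 : LinearMap.trace ℝ _ (warpTensor G φ y V ∘ₗ warpTensor G φ y W) =
      ∑ k, (Module.finrank ℝ (E k) : ℝ) * (fderiv ℝ (φ k) y V * fderiv ℝ (φ k) y W) +
        2 * (fderiv ℝ (φ i) y V * fderiv ℝ (φ i) y W) -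
        2 * (blockForm G y i V W * fderiv ℝ (φ i) y (warpGrad G φ y i)) :=
    trace_shape_comp_shape (m := fun k => (Module.finrank ℝ (E k) : ℝ)) trace_blockProj
      blockProj_comp_blockProj hPV hPW hbV hbW ((hG i).symm.self_of_nhds _ _) (hNP v) (hNP w)
      (hNb v) (hNb w)
  rw [hcurv]
  simp only [map_add, map_sub, map_sum, map_smul, trace_single_comp_comp_proj,
    LinearMap.trace_smulRight, hT3, hT4, trace_blockProj, hDN, hVW, smul_eq_mul,
    ContinuousLinearMap.coe_coe, ContinuousLinearMap.flip_apply]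
  have hS' : ∀ k, fderiv ℝ (φ k) y (warpTensor G φ y V W) =
      fderiv ℝ (φ i) y V * fderiv ℝ (φ k) y W + fderiv ℝ (φ k) y V * fderiv ℝ (φ i) y W -
        G i (y i) v w * fderiv ℝ (φ k) y (warpGrad G φ y i) := fun k => by
    rw [hS]
    simp only [map_add, map_sub, map_smul, smul_eq_mul]
    ring
  simp only [hS']
  have hc : ∀ k, H k V W * (Module.finrank ℝ (E k) : ℝ) = Module.finrank ℝ (E k) * H k V W :=
    fun k => mul_comm _ _
  simp only [hc]
  change LinearMap.trace ℝ _ (curvature (G i) (y i) v w) + _ - _ - _ + _ + _ - _ =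
    LinearMap.trace ℝ _ (curvature (G i) (y i) v w) + _ - _ - _ + _ - _
  ring

/-- The scalar curvature of a multiconformal metric in coordinates. -/
theorem coordScalarCurvature_multiMetric (hG : ∀ i, IsMetricAt (G i) (y i))
    (hφ : ∀ i, ContDiffAt ℝ 2 (φ i) y) :
    coordScalarCurvature (multiMetric G φ) y = ∑ j, Real.exp (-(2 * φ j y)) *
      (coordScalarCurvature (G j) (y j) + 2 * partialLaplacian G φ y j j -
        2 * ∑ k, Module.finrank ℝ (E k) * partialLaplacian G φ y j k -
        ∑ k, Module.finrank ℝ (E k) * partialInner G φ y j k k +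
        4 * ∑ k, Module.finrank ℝ (E k) * partialInner G φ y j j k -
        ∑ k, Module.finrank ℝ (E k) * ∑ l, Module.finrank ℝ (E l) * partialInner G φ y j k l -
        2 * partialInner G φ y j j j) := by
  set m : ι → ℝ := fun k => Module.finrank ℝ (E k) with hm
  -- `A i` collects terms differentiated only along factor `i`. `C i j` collects the derivatives
  -- along factor `j` that enter the `i`-th Ricci block as multiples of `G i`, through `warpHess`
  -- and `warpGrad`; tracing `G i` gives the factor `m i`.
  let A : ι → ℝ := fun i => coordScalarCurvature (G i) (y i) + 2 * partialLaplacian G φ y i i -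
    ∑ k, m k * partialLaplacian G φ y i k + 2 * ∑ k, m k * partialInner G φ y i i k -
    ∑ k, m k * partialInner G φ y i k k - 2 * partialInner G φ y i i i
  let C : ι → ι → ℝ := fun i j => m i * (2 * partialInner G φ y j j i -
    partialLaplacian G φ y j i - ∑ k, m k * partialInner G φ y j k i)
  have h1 : coordScalarCurvature (multiMetric G φ) y =
      ∑ i, Real.exp (-(2 * φ i y)) * (A i + ∑ j, Real.exp (2 * φ i y - 2 * φ j y) * C i j) := by
    rw [coordScalarCurvature, trace_pi_eq_sum]
    refine Finset.sum_congr rfl fun i _ => ?_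
    let α : ι → E i →L[ℝ] ℝ := fun k =>
      (fderiv ℝ (φ k) y).comp (ContinuousLinearMap.single ℝ E i)
    let pH : ι → E i →L[ℝ] E i →L[ℝ] ℝ := fun k =>
      pullback (ContinuousLinearMap.single ℝ E i) (hessian (directMetric G) (φ k) y)
    let B : E i →L[ℝ] E i →L[ℝ] ℝ := (2 : ℝ) • pH i - ∑ k, m k • pH k -
      LinearMap.trace ℝ (∀ i, E i) (warpHess G φ y i) • G i (y i) +
      ∑ k, m k • ((α i).smulRight (α k) + (α k).smulRight (α i) -
        fderiv ℝ (φ k) y (warpGrad G φ y i) • G i (y i)) -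
      (∑ k, m k • (α k).smulRight (α k) + (2 : ℝ) • (α i).smulRight (α i) -
        (2 : ℝ) • fderiv ℝ (φ i) y (warpGrad G φ y i) • G i (y i))
    have hB : ∀ v, (LinearMap.toContinuousLinearMap
        (ricci (multiMetric G φ) y (Pi.single i v))).comp (ContinuousLinearMap.single ℝ E i) =
        LinearMap.toContinuousLinearMap (ricci (G i) (y i) v) + B v := fun v => by
      ext w
      change ricci (multiMetric G φ) y (Pi.single i v) (Pi.single i w) = ricci (G i) (y i) v w +
        B v w
      rw [ricci_multiMetric hG hφ]
      simp only [B, α, pH, add_apply, sub_apply, sum_apply, smul_apply, smul_eq_mul,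
        ContinuousLinearMap.smulRight_apply, pullback_apply, ContinuousLinearMap.comp_apply,
        ContinuousLinearMap.single_apply, hm]
      simp only [mul_comm (G i (y i) v w)]
      ring
    have h2 : LinearMap.proj i ∘ₗ ricciSharp (multiMetric G φ) y ∘ₗ LinearMap.single ℝ E i =
        Real.exp (-(2 * φ i y)) • (ricciSharp (G i) (y i) +
          (((G i (y i)).inverse.comp B : E i →L[ℝ] E i) : E i →ₗ[ℝ] E i)) := by
      refine LinearMap.ext fun v => ?_
      change (multiMetric G φ y).inverse (LinearMap.toContinuousLinearMap
        (ricci (multiMetric G φ) y (Pi.single i v))) i = _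
      rw [inverse_multiMetric fun i => (hG i).isInvertible, multiInverse_apply, hB, map_add]
      rfl
    have hα : ∀ k l, α k ((G i (y i)).inverse (α l)) = partialInner G φ y i k l :=
      fun k l => rfl
    have hL : ∀ k, metricTrace (G i (y i)) (pH k) = partialLaplacian G φ y i k := fun k => rfl
    have h3 : metricTrace (G i (y i)) B = 2 * partialLaplacian G φ y i i -
        ∑ k, m k * partialLaplacian G φ y i k -
        LinearMap.trace ℝ (∀ i, E i) (warpHess G φ y i) * m i +
        ∑ k, m k * (partialInner G φ y i i k + partialInner G φ y i i k -
          fderiv ℝ (φ k) y (warpGrad G φ y i) * m i) -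
        (∑ k, m k * partialInner G φ y i k k + 2 * partialInner G φ y i i i -
          2 * (fderiv ℝ (φ i) y (warpGrad G φ y i) * m i)) := by
      simp only [B, metricTrace_add, metricTrace_sub, metricTrace_sum, metricTrace_smul,
        metricTrace_smulRight, metricTrace_self (hG i).isInvertible, hα, hL]
      simp only [partialInner_symm hG i _ i, hm]
    rw [h2, map_smul, map_add, smul_eq_mul]
    congr 1
    change coordScalarCurvature (G i) (y i) + metricTrace (G i (y i)) B = _
    rw [h3, trace_warpHess]
    simp only [fderiv_apply_warpGrad, A, C]
    have h4 : ∑ k, m k * (partialInner G φ y i i k + partialInner G φ y i i k -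
        (∑ j, Real.exp (2 * φ i y - 2 * φ j y) * partialInner G φ y j k i) * m i) =
        2 * ∑ k, m k * partialInner G φ y i i k - ∑ j, Real.exp (2 * φ i y - 2 * φ j y) *
          (m i * ∑ k, m k * partialInner G φ y j k i) := by
      simp only [mul_sub, Finset.sum_sub_distrib, Finset.mul_sum, Finset.sum_mul]
      congr 1
      · exact Finset.sum_congr rfl fun k _ => by ring
      · rw [Finset.sum_comm]
        exact Finset.sum_congr rfl fun j _ => Finset.sum_congr rfl fun k _ => by ring
    rw [h4]
    have h5 : ∑ j, Real.exp (2 * φ i y - 2 * φ j y) * (m i * (2 * partialInner G φ y j j i -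
        partialLaplacian G φ y j i - ∑ k, m k * partialInner G φ y j k i)) =
        2 * ((∑ j, Real.exp (2 * φ i y - 2 * φ j y) * partialInner G φ y j i i) * m i) -
        (∑ j, Real.exp (2 * φ i y - 2 * φ j y) * (2 * (partialInner G φ y j i i -
          partialInner G φ y j j i) + partialLaplacian G φ y j i)) * m i -
        ∑ j, Real.exp (2 * φ i y - 2 * φ j y) * (m i * ∑ k, m k * partialInner G φ y j k i) := by
      rw [Finset.sum_mul, Finset.sum_mul, Finset.mul_sum, ← Finset.sum_sub_distrib,
        ← Finset.sum_sub_distrib]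
      exact Finset.sum_congr rfl fun j _ => by ring
    rw [h5]
    ring
  -- The weight depends only on the factor along which one differentiates, so exchanging the sums
  -- regroups everything by that factor.
  have h6 : ∀ i j, Real.exp (-(2 * φ i y)) * (Real.exp (2 * φ i y - 2 * φ j y) * C i j) =
      Real.exp (-(2 * φ j y)) * C i j := fun i j => by
    rw [← mul_assoc, ← Real.exp_add]
    congr 2
    ring
  rw [h1]
  simp only [mul_add, Finset.mul_sum, h6, Finset.sum_add_distrib]
  rw [Finset.sum_comm]
  simp only [← Finset.mul_sum, ← Finset.sum_add_distrib, ← mul_add]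
  refine Finset.sum_congr rfl fun j _ => ?_
  congr 1
  have h7 : ∑ i, C i j = 2 * ∑ k, m k * partialInner G φ y j j k -
      ∑ k, m k * partialLaplacian G φ y j k -
      ∑ k, m k * ∑ l, m l * partialInner G φ y j k l := by
    simp only [C, Finset.mul_sum, ← Finset.sum_sub_distrib]
    refine Finset.sum_congr rfl fun k _ => ?_
    simp only [mul_sub, Finset.mul_sum, partialInner_symm hG j k]
    ring
  rw [h7]
  simp only [A, hm]
  ring

end CoordinateScalar

end Multiconformal

/-! ### Specialization to permutation type -/

namespace Multiconformal

/-- The squared norm of the gradient of `U` with respect to the metric `G`. -/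
def gradSq {E : Type*} [NormedAddCommGroup E] [NormedSpace ℝ E] (G : E → E →L[ℝ] E →L[ℝ] ℝ)
    (U : E → ℝ) (y : E) : ℝ :=
  fderiv ℝ U y ((G y).inverse (fderiv ℝ U y))

section PermutationType

variable {ι : Type*} {E : ι → Type*} [∀ i, NormedAddCommGroup (E i)]
  [∀ i, NormedSpace ℝ (E i)]
  {G : ∀ i, E i → E i →L[ℝ] E i →L[ℝ] ℝ} {y : ∀ i, E i}

theorem hasFDerivAt_comp_proj [Fintype ι] {j : ι} {F : Type*} [NormedAddCommGroup F]
    [NormedSpace ℝ F] {U : E j → F} (hU : DifferentiableAt ℝ U (y j)) :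
    HasFDerivAt (fun z : ∀ i, E i => U (z j))
      ((fderiv ℝ U (y j)).comp (ContinuousLinearMap.proj (R := ℝ) (φ := E) j)) y :=
  HasFDerivAt.comp y hU.hasFDerivAt (ContinuousLinearMap.proj (R := ℝ) (φ := E) j).hasFDerivAt

theorem fderiv_fderiv_comp_proj [Fintype ι] {j : ι} {U : E j → ℝ} (hU : ContDiffAt ℝ 2 U (y j))
    (v w : ∀ i, E i) :
    fderiv ℝ (fderiv ℝ fun z : ∀ i, E i => U (z j)) y v w =
      fderiv ℝ (fderiv ℝ U) (y j) (v j) (w j) := by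
  have hd : DifferentiableAt ℝ (fderiv ℝ U) (y j) :=
    (hU.fderiv_right (m := 1) (by norm_num)).differentiableAt (by norm_num)
  have h1 : fderiv ℝ (fun z : ∀ i, E i => U (z j)) =ᶠ[nhds y] fun z =>
      (ContinuousLinearMap.compL ℝ (∀ i, E i) (E j) ℝ).flip
        (ContinuousLinearMap.proj (R := ℝ) (φ := E) j) (fderiv ℝ U (z j)) := by
    have h2 : ∀ᶠ z in nhds y, ContDiffAt ℝ 2 U (z j) :=
      (continuous_apply j).continuousAt.eventually (hU.eventually (by norm_num))
    filter_upwards [h2] with z hz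
    exact (hasFDerivAt_comp_proj (y := z) (hz.differentiableAt (by norm_num))).fderiv
  have h3 := ((ContinuousLinearMap.compL ℝ (∀ i, E i) (E j) ℝ).flip
    (ContinuousLinearMap.proj (R := ℝ) (φ := E) j)).hasFDerivAt.comp y (hasFDerivAt_comp_proj hd)
  rw [h1.fderiv_eq]
  exact DFunLike.congr_fun (DFunLike.congr_fun h3.fderiv v) w

variable [Fintype ι] [DecidableEq ι] {σ : Equiv.Perm ι} {U : ∀ k, E (σ k) → ℝ}

theorem partialGrad_eq_zero (hU : ∀ k, ContDiffAt ℝ 2 (U k) (y (σ k))) {j k : ι} (h : j ≠ σ k) :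
    partialGrad G (fun k z => U k (z (σ k))) j k y = 0 := by
  have h1 : (fderiv ℝ (fun z : ∀ i, E i => U k (z (σ k))) y).comp
      (ContinuousLinearMap.single ℝ E j) = 0 := by
    rw [(hasFDerivAt_comp_proj ((hU k).differentiableAt (by norm_num))).fderiv]
    ext v
    simp [Pi.single_eq_of_ne h.symm]
  rw [partialGrad, h1, map_zero]

theorem partialInner_eq_zero (hU : ∀ k, ContDiffAt ℝ 2 (U k) (y (σ k)))
    {j l : ι} (k : ι) (h : j ≠ σ l) :
    partialInner G (fun k z => U k (z (σ k))) y j k l = 0 := by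
  rw [partialInner, partialGrad_eq_zero hU h, Pi.single_zero, map_zero]

theorem partialInner_eq_gradSq (hU : ∀ k, ContDiffAt ℝ 2 (U k) (y (σ k))) (k : ι) :
    partialInner G (fun k z => U k (z (σ k))) y (σ k) k k =
      gradSq (G (σ k)) (U k) (y (σ k)) := by
  have h1 : (fderiv ℝ (fun z : ∀ i, E i => U k (z (σ k))) y).comp
      (ContinuousLinearMap.single ℝ E (σ k)) = fderiv ℝ (U k) (y (σ k)) := by
    rw [(hasFDerivAt_comp_proj ((hU k).differentiableAt (by norm_num))).fderiv]
    ext v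
    simp
  rw [partialInner, partialGrad, h1, ← h1, gradSq, h1,
    (hasFDerivAt_comp_proj ((hU k).differentiableAt (by norm_num))).fderiv]
  simp

theorem hessian_comp_proj (hG : ∀ i, IsMetricAt (G i) (y i)) {j : ι} {U : E j → ℝ}
    (hU : ContDiffAt ℝ 2 U (y j)) (v w : ∀ i, E i) :
    hessian (directMetric G) (fun z => U (z j)) y v w = hessian (G j) U (y j) (v j) (w j) := by
  rw [hessian_apply, hessian_apply, fderiv_fderiv_comp_proj hU,
    (hasFDerivAt_comp_proj (hU.differentiableAt (by norm_num))).fderiv,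
    christoffel_directMetric hG]
  rfl

theorem partialLaplacian_eq_zero (hG : ∀ i, IsMetricAt (G i) (y i))
    (hU : ∀ k, ContDiffAt ℝ 2 (U k) (y (σ k))) {j k : ι} (h : j ≠ σ k) :
    partialLaplacian G (fun k z => U k (z (σ k))) y j k = 0 := by
  have h1 : pullback (ContinuousLinearMap.single ℝ E j)
      (hessian (directMetric G) (fun z : ∀ i, E i => U k (z (σ k))) y) = 0 := by
    ext v w
    rw [pullback_apply, hessian_comp_proj hG (hU k)]
    simp [Pi.single_eq_of_ne h.symm]
  rw [partialLaplacian, h1]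
  simp [metricTrace]

theorem partialLaplacian_eq_laplacian (hG : ∀ i, IsMetricAt (G i) (y i))
    (hU : ∀ k, ContDiffAt ℝ 2 (U k) (y (σ k))) (k : ι) :
    partialLaplacian G (fun k z => U k (z (σ k))) y (σ k) k =
      laplacian (G (σ k)) (U k) (y (σ k)) := by
  have h1 : pullback (ContinuousLinearMap.single ℝ E (σ k))
      (hessian (directMetric G) (fun z : ∀ i, E i => U k (z (σ k))) y) =
      hessian (G (σ k)) (U k) (y (σ k)) := by
    ext v w
    rw [pullback_apply, hessian_comp_proj hG (hU k)]
    simp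
  rw [partialLaplacian, h1, laplacian]

variable [∀ i, FiniteDimensional ℝ (E i)]

/-- The scalar curvature of a multiconformal metric of permutation type, in coordinates. -/
theorem coordScalarCurvature_of_permutation (hG : ∀ i, IsMetricAt (G i) (y i))
    (hU : ∀ k, ContDiffAt ℝ 2 (U k) (y (σ k))) :
    coordScalarCurvature (multiMetric G fun k z => U k (z (σ k))) y =
      ∑ j, Real.exp (-(2 * U j (y (σ j)))) * coordScalarCurvature (G j) (y j) -
      ∑ k, Real.exp (-(2 * U (σ k) (y (σ (σ k))))) *
        ((2 * Module.finrank ℝ (E k) - if σ k = k then 2 else 0) *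
            laplacian (G (σ k)) (U k) (y (σ k)) +
          (Module.finrank ℝ (E k) + (Module.finrank ℝ (E k) : ℝ) ^ 2 -
            if σ k = k then 4 * (Module.finrank ℝ (E k) : ℝ) - 2 else 0) *
            gradSq (G (σ k)) (U k) (y (σ k))) := by
  set φ : ι → (∀ i, E i) → ℝ := fun k z => U k (z (σ k)) with hφ
  have hφ2 : ∀ i, ContDiffAt ℝ 2 (φ i) y := fun i => ContDiffAt.comp y (hU i)
    (ContinuousLinearMap.proj (R := ℝ) (φ := E) (σ i)).contDiff.contDiffAt
  set m : ι → ℝ := fun k => Module.finrank ℝ (E k) with hm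
  -- Reindexed by `σ`, the block `σ k` is the only one along which `φ k` varies, so every sum over
  -- conformal factors reduces to its `k`-th term.
  rw [coordScalarCurvature_multiMetric hG hφ2, eq_sub_iff_add_eq,
    ← Equiv.sum_comp σ fun j => Real.exp (-(2 * φ j y)) * _,
    ← Equiv.sum_comp σ fun j => Real.exp (-(2 * U j (y (σ j)))) * _, ← Finset.sum_add_distrib]
  refine Finset.sum_congr rfl fun k _ => ?_
  have hne : ∀ l, l ≠ k → σ k ≠ σ l := fun l hl h => hl (σ.injective h).symm
  have hI0 : ∀ a l, l ≠ k → partialInner G φ y (σ k) a l = 0 := fun a l hl =>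
    partialInner_eq_zero hU a (hne l hl)
  have hI0' : ∀ a l, l ≠ k → partialInner G φ y (σ k) l a = 0 := fun a l hl => by
    rw [partialInner_symm hG, hI0 a l hl]
  have hL0 : ∀ l, l ≠ k → partialLaplacian G φ y (σ k) l = 0 := fun l hl =>
    partialLaplacian_eq_zero hG hU (hne l hl)
  have hI : partialInner G φ y (σ k) k k = gradSq (G (σ k)) (U k) (y (σ k)) :=
    partialInner_eq_gradSq hU k
  have hL : partialLaplacian G φ y (σ k) k = laplacian (G (σ k)) (U k) (y (σ k)) :=
    partialLaplacian_eq_laplacian hG hU k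
  have s1 : ∀ c : ι → ℝ, (∀ l, l ≠ k → c l = 0) → ∑ l, m l * c l = m k * c k := fun c hc =>
    Finset.sum_eq_single k (fun l _ hl => by rw [hc l hl, mul_zero]) (by simp)
  rw [s1 _ hL0, s1 _ fun l hl => hI0 l l hl, s1 _ fun l hl => hI0 (σ k) l hl,
    s1 (fun a => ∑ l, m l * partialInner G φ y (σ k) a l) fun a ha =>
      Finset.sum_eq_zero fun l _ => by rw [hI0' l a ha, mul_zero],
    s1 _ fun l hl => hI0 k l hl, ← hI, ← hL]
  -- The terms whose function has the index of the block itself involve `φ (σ k)`, which varies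
  -- along the block `σ k` only if `σ k = k`; they are the source of the corrections `2` and `4 m -
  -- 2`.
  by_cases h : σ k = k
  · rw [if_pos h, if_pos h, congrArg (partialLaplacian G φ y (σ k)) h,
      congrArg (fun a => partialInner G φ y (σ k) a k) h,
      congrArg (fun a => partialInner G φ y (σ k) a a) h]
    ring
  · rw [if_neg h, if_neg h, hL0 _ h, hI0' k _ h, hI0' _ _ h]
    ring

end PermutationType

end Multiconformal

namespace Multiconformal

open Filter Topology

/-! ### Coordinate invariance of the Laplacian and gradient norm -/

section ChangeOfCoordinates

variable {E : Type*} [NormedAddCommGroup E] [NormedSpace ℝ E]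
  {G G' : E → E →L[ℝ] E →L[ℝ] ℝ} {Φ : E → E} {U U' : E → ℝ} {y : E}

/-- In the Koszul combination of the pulled back metric the second derivatives of `Φ` cancel by
symmetry, except for twice the pairing with `D²Φ(u, v)`. This is the inhomogeneous term of the
transformation law. -/
theorem christoffel_pullback (hG : IsMetricAt G (Φ y)) (hG' : IsMetricAt G' y)
    (hΦ : ContDiffAt ℝ 2 Φ y) (hD : (fderiv ℝ Φ y).IsInvertible)
    (h : G' =ᶠ[𝓝 y] fun z => pullback (fderiv ℝ Φ z) (G (Φ z))) (u v : E) :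
    fderiv ℝ Φ y (christoffel G' y u v) =
      christoffel G (Φ y) (fderiv ℝ Φ y u) (fderiv ℝ Φ y v) +
        fderiv ℝ (fderiv ℝ Φ) y u v := by
  have hd1 : DifferentiableAt ℝ Φ y := hΦ.differentiableAt (by norm_num)
  have hd2 : DifferentiableAt ℝ (fderiv ℝ Φ) y :=
    (hΦ.fderiv_right (m := 1) (by norm_num)).differentiableAt (by norm_num)
  have hsymm : ∀ a b, fderiv ℝ (fderiv ℝ Φ) y a b = fderiv ℝ (fderiv ℝ Φ) y b a :=
    (hΦ.isSymmSndFDerivAt (by simp)).eq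
  have hG0 : ∀ a b, G' y a b = G (Φ y) (fderiv ℝ Φ y a) (fderiv ℝ Φ y b) := fun a b => by
    rw [h.self_of_nhds, pullback_apply]
  have hdG : ∀ a b c, fderiv ℝ G' y a b c =
      fderiv ℝ G (Φ y) (fderiv ℝ Φ y a) (fderiv ℝ Φ y b) (fderiv ℝ Φ y c) +
      G (Φ y) (fderiv ℝ (fderiv ℝ Φ) y a b) (fderiv ℝ Φ y c) +
      G (Φ y) (fderiv ℝ Φ y b) (fderiv ℝ (fderiv ℝ Φ) y a c) := fun a b c => by
    have h1 := hasDerivAt_metric_line hG'.differentiableAt (hasDerivAt_const 0 b)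
      (hasDerivAt_const 0 c) a
    have hc : HasFDerivAt (fun z => G (Φ z)) ((fderiv ℝ G (Φ y)).comp (fderiv ℝ Φ y)) y :=
      hG.differentiableAt.hasFDerivAt.comp y hd1.hasFDerivAt
    have h2 : ∀ b, HasDerivAt (fun t : ℝ => fderiv ℝ Φ (y + t • a) b)
        (fderiv ℝ (fderiv ℝ Φ) y a b) 0 := fun b => by
      simpa using (hasDerivAt_comp_line hd2 a).clm_apply (hasDerivAt_const 0 b)
    have h3 := hasDerivAt_metric_line hc.differentiableAt (h2 b) (h2 c) a
    have h4 : (fun t : ℝ => G' (y + t • a) b c) =ᶠ[𝓝 0] fun t : ℝ =>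
        G (Φ (y + t • a)) (fderiv ℝ Φ (y + t • a) b) (fderiv ℝ Φ (y + t • a) c) := by
      filter_upwards [eventually_line h a] with t ht
      rw [ht, pullback_apply]
    have h5 := h1.unique (h3.congr_of_eventuallyEq h4)
    simpa [hc.fderiv] using h5
  have hX : christoffel G' y u v = (fderiv ℝ Φ y).inverse
      (christoffel G (Φ y) (fderiv ℝ Φ y u) (fderiv ℝ Φ y v) +
        fderiv ℝ (fderiv ℝ Φ) y u v) := by
    refine christoffel_eq_of_forall hG'.isInvertible fun w => ?_
    rw [hG0, hD.self_apply_inverse, map_add, add_apply,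
      apply_christoffel hG.isInvertible, koszul_apply, koszul_apply, hdG, hdG, hdG, hsymm v u,
      hsymm w u, hsymm w v, hG.symm.self_of_nhds (fderiv ℝ Φ y u),
      hG.symm.self_of_nhds (fderiv ℝ Φ y v)]
    ring
  rw [hX, hD.self_apply_inverse]

theorem fderiv_fderiv_comp (hU : ContDiffAt ℝ 2 U (Φ y)) (hΦ : ContDiffAt ℝ 2 Φ y)
    (h : U' =ᶠ[𝓝 y] U ∘ Φ) (v w : E) :
    fderiv ℝ (fderiv ℝ U') y v w =
      fderiv ℝ (fderiv ℝ U) (Φ y) (fderiv ℝ Φ y v) (fderiv ℝ Φ y w) +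
        fderiv ℝ U (Φ y) (fderiv ℝ (fderiv ℝ Φ) y v w) := by
  have hd1 : DifferentiableAt ℝ Φ y := hΦ.differentiableAt (by norm_num)
  have hd2 : DifferentiableAt ℝ (fderiv ℝ Φ) y :=
    (hΦ.fderiv_right (m := 1) (by norm_num)).differentiableAt (by norm_num)
  have hd3 : DifferentiableAt ℝ (fderiv ℝ U) (Φ y) :=
    (hU.fderiv_right (m := 1) (by norm_num)).differentiableAt (by norm_num)
  have h1 : fderiv ℝ U' =ᶠ[𝓝 y] fun z => (fderiv ℝ U (Φ z)).comp (fderiv ℝ Φ z) := by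
    filter_upwards [h.eventuallyEq_nhds, hΦ.eventually (by norm_num),
      hΦ.continuousAt.eventually (hU.eventually (by norm_num))] with z hz1 hz2 hz3
    rw [hz1.fderiv_eq]
    exact fderiv_comp z (hz3.differentiableAt (by norm_num)) (hz2.differentiableAt (by norm_num))
  have h2 := ((hd3.hasFDerivAt.comp y hd1.hasFDerivAt).clm_comp hd2.hasFDerivAt)
  have h3 := DFunLike.congr_fun (DFunLike.congr_fun (h2.congr_of_eventuallyEq h1).fderiv v) w
  rw [h3]
  simp [add_comm]

theorem inverse_pullback {g : E →L[ℝ] E →L[ℝ] ℝ} {D : E →L[ℝ] E} (hg : g.IsInvertible)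
    (hD : D.IsInvertible) (hg' : (pullback D g).IsInvertible) (ℓ : E →L[ℝ] ℝ) :
    D ((pullback D g).inverse (ℓ.comp D)) = g.inverse ℓ := by
  have h : (pullback D g).inverse (ℓ.comp D) = D.inverse (g.inverse ℓ) := by
    rw [hg'.inverse_apply_eq]
    ext w
    rw [pullback_apply, hD.self_apply_inverse, hg.self_apply_inverse]
    rfl
  rw [h, hD.self_apply_inverse]

/-- Raising an index after pulling back conjugates the operator by `D`, and traces are conjugation
invariant. -/
theorem metricTrace_pullback {g B : E →L[ℝ] E →L[ℝ] ℝ} {D : E →L[ℝ] E} (hg : g.IsInvertible)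
    (hD : D.IsInvertible) (hg' : (pullback D g).IsInvertible) :
    metricTrace (pullback D g) (pullback D B) = metricTrace g B := by
  obtain ⟨e, rfl⟩ := hD
  have h : ((pullback (e : E →L[ℝ] E) g).inverse.comp (pullback (e : E →L[ℝ] E) B) :
      E →ₗ[ℝ] E) = e.symm.toLinearEquiv.conj (g.inverse.comp B : E →L[ℝ] E) := by
    refine LinearMap.ext fun v => ?_
    apply e.injective
    have := inverse_pullback hg ⟨e, rfl⟩ hg' (B (e v))
    change e ((pullback (e : E →L[ℝ] E) g).inverse ((B (e v)).comp (e : E →L[ℝ] E))) =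
      e (e.symm (g.inverse (B (e.symm.symm v))))
    simpa using this
  rw [metricTrace, h, LinearMap.trace_conj', metricTrace]

/-- The `D²Φ` term in the second derivative of `U ∘ Φ` cancels the inhomogeneous term of the
Christoffel symbols, so the Hessian is a tensor. -/
theorem laplacian_pullback (hG : IsMetricAt G (Φ y)) (hG' : IsMetricAt G' y)
    (hΦ : ContDiffAt ℝ 2 Φ y) (hD : (fderiv ℝ Φ y).IsInvertible)
    (h : G' =ᶠ[𝓝 y] fun z => pullback (fderiv ℝ Φ z) (G (Φ z)))
    (hU : ContDiffAt ℝ 2 U (Φ y)) (hU' : U' =ᶠ[𝓝 y] U ∘ Φ) :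
    laplacian G' U' y = laplacian G U (Φ y) := by
  have h0 : G' y = pullback (fderiv ℝ Φ y) (G (Φ y)) := h.self_of_nhds
  have h1 : hessian G' U' y = pullback (fderiv ℝ Φ y) (hessian G U (Φ y)) := by
    ext v w
    rw [pullback_apply, hessian_apply, hessian_apply, fderiv_fderiv_comp hU hΦ hU',
      hU'.fderiv_eq, fderiv_comp y (hU.differentiableAt (by norm_num))
        (hΦ.differentiableAt (by norm_num)), ContinuousLinearMap.comp_apply,
      christoffel_pullback hG hG' hΦ hD h, map_add]
    ring
  rw [laplacian, laplacian, h1, h0,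
    metricTrace_pullback hG.isInvertible hD (h0 ▸ hG'.isInvertible)]

theorem gradSq_pullback (hG : IsMetricAt G (Φ y)) (hG' : IsMetricAt G' y)
    (hΦ : ContDiffAt ℝ 2 Φ y) (hD : (fderiv ℝ Φ y).IsInvertible)
    (h : G' =ᶠ[𝓝 y] fun z => pullback (fderiv ℝ Φ z) (G (Φ z)))
    (hU : ContDiffAt ℝ 2 U (Φ y)) (hU' : U' =ᶠ[𝓝 y] U ∘ Φ) :
    gradSq G' U' y = gradSq G U (Φ y) := by
  have h0 : G' y = pullback (fderiv ℝ Φ y) (G (Φ y)) := h.self_of_nhds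
  rw [gradSq, gradSq, hU'.fderiv_eq, fderiv_comp y (hU.differentiableAt (by norm_num))
    (hΦ.differentiableAt (by norm_num)), ContinuousLinearMap.comp_apply, h0,
    inverse_pullback hG.isInvertible hD (h0 ▸ hG'.isInvertible)]

end ChangeOfCoordinates

/-! ### Second-order conditions and the strong maximum principle -/

section MaximumPrinciple

variable {E : Type*} [NormedAddCommGroup E]

section Normed

variable [NormedSpace ℝ E]

theorem gradSq_pos {G : E → E →L[ℝ] E →L[ℝ] ℝ} {U : E → ℝ} {y : E} (hG : (G y).IsInvertible)
    (hpos : ∀ v, v ≠ 0 → 0 < G y v v) (hU : fderiv ℝ U y ≠ 0) : 0 < gradSq G U y := by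
  have h : (G y).inverse (fderiv ℝ U y) ≠ 0 := fun h => hU (by
    rw [hG.inverse_apply_eq, map_zero] at h
    exact h)
  have := hpos _ h
  rwa [hG.self_apply_inverse] at this

/-- In a `g`-orthogonal basis the diagonal entries of the operator are `B(e, e) / g(e, e)`. -/
theorem metricTrace_nonpos [FiniteDimensional ℝ E] {g B : E →L[ℝ] E →L[ℝ] ℝ}
    (hg : g.IsInvertible) (hsymm : ∀ v w, g v w = g w v) (hpos : ∀ v, v ≠ 0 → 0 < g v v)
    (hB : ∀ v, B v v ≤ 0) : metricTrace g B ≤ 0 := by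
  let b : LinearMap.BilinForm ℝ E :=
    (ContinuousLinearMap.coeLM ℝ : (E →L[ℝ] ℝ) →ₗ[ℝ] E →ₗ[ℝ] ℝ) ∘ₗ (g : E →ₗ[ℝ] E →L[ℝ] ℝ)
  have hb : ∀ v w, b v w = g v w := fun v w => rfl
  obtain ⟨e, he⟩ := LinearMap.BilinForm.exists_orthogonal_basis (B := b) ⟨fun v w => hsymm v w⟩
  have hrepr : ∀ x i, e.repr x i * g (e i) (e i) = g x (e i) := fun x i => by
    conv_rhs => rw [← e.sum_repr x, map_sum, sum_apply]
    rw [Finset.sum_eq_single i]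
    · simp
    · intro j _ hj
      have : b (e j) (e i) = 0 := he hj
      rw [hb] at this
      simp [this]
    · simp
  rw [metricTrace, LinearMap.trace_eq_matrix_trace ℝ e, Matrix.trace]
  refine Finset.sum_nonpos fun i _ => ?_
  rw [Matrix.diag_apply, LinearMap.toMatrix_apply]
  have h1 := hpos (e i) (e.ne_zero i)
  have h2 := hrepr (g.inverse (B (e i))) i
  rw [hg.self_apply_inverse] at h2
  have h3 := hB (e i)
  rw [← h2] at h3
  exact nonpos_of_mul_nonpos_left h3 h1

/-- Restrict to a line. A positive second derivative would make the point a local minimum as well,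
so the restriction would be locally constant, with second derivative zero. -/
theorem IsLocalMax.fderiv_fderiv_nonpos {w : E → ℝ} {y : E} (hw : ContDiffAt ℝ 2 w y)
    (h : IsLocalMax w y) (v : E) : fderiv ℝ (fderiv ℝ w) y v v ≤ 0 := by
  by_contra! hlt
  have hd2 : DifferentiableAt ℝ (fderiv ℝ w) y :=
    (hw.fderiv_right (m := 1) (by norm_num)).differentiableAt (by norm_num)
  let f : ℝ → ℝ := fun t => w (y + t • v)
  have h1 : deriv f =ᶠ[𝓝 0] fun t => fderiv ℝ w (y + t • v) v := by
    filter_upwards [eventually_line (hw.eventually (by norm_num)) v] with t ht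
    have h2 : HasDerivAt (fun t : ℝ => y + t • v) v t := by
      simpa using ((hasDerivAt_id t).smul_const v).const_add y
    exact ((ht.differentiableAt (by norm_num)).hasFDerivAt.comp_hasDerivAt t h2).deriv
  have h3 : deriv (deriv f) 0 = fderiv ℝ (fderiv ℝ w) y v v := by
    rw [h1.deriv_eq]
    simpa using ((hasDerivAt_comp_line hd2 v).clm_apply (hasDerivAt_const 0 v)).deriv
  have h4 : deriv f 0 = 0 := by
    rw [h1.self_of_nhds]
    simp [h.fderiv_eq_zero]
  have h5 : HasDerivAt f _ 0 := hasDerivAt_comp_line (hw.differentiableAt (by norm_num)) v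
  have h6 := isLocalMin_of_deriv_deriv_pos (h3 ▸ hlt) h4 h5.continuousAt
  have h7 : ∀ᶠ t in 𝓝 0, f t ≤ f 0 := by
    have h8 := eventually_line (p := fun z => w z ≤ w y) h v
    simpa [f] using h8
  have h8 : f =ᶠ[𝓝 0] fun _ => f 0 := by
    filter_upwards [h6, h7] with t ht1 ht2 using le_antisymm ht2 ht1
  have h9 : deriv (deriv f) 0 = 0 := by
    rw [h8.deriv.deriv_eq]
    simp
  rw [h3] at h9
  exact hlt.ne' h9

theorem laplacian_nonpos_of_isLocalMax [FiniteDimensional ℝ E] {G : E → E →L[ℝ] E →L[ℝ] ℝ}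
    {w : E → ℝ} {y : E} (hG : IsMetricAt G y) (hpos : ∀ v, v ≠ 0 → 0 < G y v v)
    (hw : ContDiffAt ℝ 2 w y) (h : IsLocalMax w y) : laplacian G w y ≤ 0 := by
  refine metricTrace_nonpos hG.isInvertible hG.symm.self_of_nhds hpos fun v => ?_
  rw [hessian_apply, h.fderiv_eq_zero]
  simpa using IsLocalMax.fderiv_fderiv_nonpos hw h v

theorem gradSq_eq_zero_of_isLocalMax {G : E → E →L[ℝ] E →L[ℝ] ℝ}
    {w : E → ℝ} {y : E} (h : IsLocalMax w y) : gradSq G w y = 0 := by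
  rw [gradSq, h.fderiv_eq_zero, zero_apply]

variable {G : E → E →L[ℝ] E →L[ℝ] ℝ} {s U : E → ℝ} {y : E}

theorem laplacian_add (hU : ContDiffAt ℝ 2 U y) (hs : ContDiffAt ℝ 2 s y) :
    laplacian G (fun z => U z + s z) y = laplacian G U y + laplacian G s y := by
  have h1 : fderiv ℝ (fun z => U z + s z) =ᶠ[𝓝 y] fun z => fderiv ℝ U z + fderiv ℝ s z := by
    filter_upwards [hU.eventually (by norm_num), hs.eventually (by norm_num)] with z hz1 hz2
    exact fderiv_fun_add (hz1.differentiableAt (by norm_num)) (hz2.differentiableAt (by norm_num))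
  have hd : ∀ {f : E → ℝ}, ContDiffAt ℝ 2 f y → DifferentiableAt ℝ (fderiv ℝ f) y := fun hf =>
    (hf.fderiv_right (m := 1) (by norm_num)).differentiableAt (by norm_num)
  rw [laplacian, laplacian, laplacian, ← metricTrace_add]
  congr 1
  ext v w
  rw [add_apply, add_apply, hessian_apply, hessian_apply, hessian_apply, h1.fderiv_eq,
    h1.self_of_nhds, fderiv_fun_add (hd hU) (hd hs)]
  simp only [add_apply]
  ring

/-- The Laplacian of the barrier `exp (-α s)`. -/
theorem laplacian_barrier [FiniteDimensional ℝ E] (hs : ContDiffAt ℝ 2 s y) (ε α C : ℝ) :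
    laplacian G (fun z => ε * (Real.exp (-(α * s z)) - C)) y =
      ε * Real.exp (-(α * s y)) * α * (α * gradSq G s y - laplacian G s y) := by
  have h0 : ∀ {z}, DifferentiableAt ℝ s z →
      HasFDerivAt (fun z => ε * (Real.exp (-(α * s z)) - C))
        ((-(ε * α)) • Real.exp (-(α * s z)) • fderiv ℝ s z) z := fun {z} hz => by
    refine ((((hz.hasFDerivAt.const_mul α).fun_neg.exp).sub_const C).const_mul ε).congr_fderiv ?_
    ext v
    simp
    ring
  have hd : DifferentiableAt ℝ (fderiv ℝ s) y :=
    (hs.fderiv_right (m := 1) (by norm_num)).differentiableAt (by norm_num)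
  have hd1 := hs.differentiableAt (by norm_num : (2 : ℕ∞ω) ≠ 0)
  have h1 : fderiv ℝ (fun z => ε * (Real.exp (-(α * s z)) - C)) =ᶠ[𝓝 y] fun z =>
      (-(ε * α)) • Real.exp (-(α * s z)) • fderiv ℝ s z := by
    filter_upwards [hs.eventually (by norm_num)] with z hz
    exact (h0 (hz.differentiableAt (by norm_num))).fderiv
  have h2 := (((hd1.hasFDerivAt.const_mul α).fun_neg.exp).fun_smul
    hd.hasFDerivAt).fun_const_smul (-(ε * α))
  have h3 : hessian G (fun z => ε * (Real.exp (-(α * s z)) - C)) y =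
      (ε * Real.exp (-(α * s y)) * α) •
        (α • (fderiv ℝ s y).smulRight (fderiv ℝ s y) - hessian G s y) := by
    ext v w
    rw [hessian_apply, h1.fderiv_eq, h1.self_of_nhds, h2.fderiv]
    simp [hessian_apply]
    ring
  rw [laplacian, h3, metricTrace_smul, metricTrace_sub, metricTrace_smul, metricTrace_smulRight]
  rfl

theorem continuousAt_laplacian [FiniteDimensional ℝ E] (hG : IsMetricAt G y)
    (hs : ContDiffAt ℝ 2 s y) : ContinuousAt (laplacian G s) y := by
  have h1 : ContinuousAt (fderiv ℝ (fderiv ℝ s)) y :=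
    ((hs.fderiv_right (m := 1) (by norm_num)).fderiv_right (m := 0) (by norm_num)).continuousAt
  have h2 : ContinuousAt (fderiv ℝ s) y :=
    (hs.fderiv_right (m := 1) (by norm_num)).continuousAt
  have h3 : ContinuousAt (hessian G s) y := by
    unfold hessian
    refine h1.sub (ContinuousAt.clm_comp ?_ hG.differentiableAt_christoffel.continuousAt)
    exact (ContinuousLinearMap.continuous _).continuousAt.comp h2
  have h4 : ContinuousAt (fun z => (G z).inverse.comp (hessian G s z)) y :=
    hG.differentiableAt_inverse.continuousAt.clm_comp h3
  have h5 : Continuous fun L : E →L[ℝ] E => LinearMap.trace ℝ E (L : E →ₗ[ℝ] E) :=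
    ((LinearMap.trace ℝ E) ∘ₗ (ContinuousLinearMap.coeLM ℝ)).continuous_of_finiteDimensional
  exact h5.continuousAt.comp h4

theorem continuousAt_inverse_apply [FiniteDimensional ℝ E] (hG : IsMetricAt G y)
    (hs : ContDiffAt ℝ 2 s y) (hU : ContDiffAt ℝ 2 U y) :
    ContinuousAt (fun z => fderiv ℝ s z ((G z).inverse (fderiv ℝ U z))) y :=
  (hs.fderiv_right (m := 1) (by norm_num)).continuousAt.clm_apply
    (hG.differentiableAt_inverse.continuousAt.clm_apply
      (hU.fderiv_right (m := 1) (by norm_num)).continuousAt)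

end Normed

variable [InnerProductSpace ℝ E] [FiniteDimensional ℝ E]

/-- The strong maximum principle on a ball. -/
theorem lt_of_subsolution {G : E → E →L[ℝ] E →L[ℝ] ℝ} {U : E → ℝ} {c : E} {R K a b : ℝ}
    (hG : ∀ z ∈ Metric.closedBall c R, IsMetricAt G z)
    (hpos : ∀ z ∈ Metric.closedBall c R, ∀ v, v ≠ 0 → 0 < G z v v)
    (hU : ∀ z ∈ Metric.closedBall c R, ContDiffAt ℝ 2 U z) (ha : 0 < a)
    (hL : ∀ z ∈ Metric.closedBall c R, 0 ≤ a * laplacian G U z + b * gradSq G U z)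
    (hle : ∀ z ∈ Metric.closedBall c R, U z ≤ K) (hc : U c < K) :
    ∀ z ∈ Metric.ball c R, U z < K := by
  intro z hz
  have hR : 0 < R := dist_nonneg.trans_lt hz
  have hcR : c ∈ Metric.closedBall c R := Metric.mem_closedBall_self hR.le
  obtain ⟨δ₀, hδ₀, hδU⟩ := Metric.eventually_nhds_iff_ball.1
    ((hU c hcR).continuousAt.eventually (gt_mem_nhds hc))
  obtain ⟨δ, hδ, hδlt⟩ := exists_between (lt_min hδ₀ hR)
  have hδR : δ < R := hδlt.trans_le (min_le_right _ _)
  have hδK : ∀ x ∈ Metric.closedBall c δ, U x < K := fun x hx =>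
    hδU x (Metric.closedBall_subset_ball (hδlt.trans_le (min_le_left _ _)) hx)
  rcases le_or_gt (dist z c) δ with hzδ | hzδ
  · exact hδK z hzδ
  let s : E → ℝ := fun x => ‖x - c‖ ^ 2
  have hs : ∀ x, ContDiffAt ℝ 2 s x := fun x =>
    ((contDiff_id.sub contDiff_const).norm_sq ℝ).contDiffAt
  -- Hopf's barrier argument lives on this annulus: it avoids the centre, the only critical point of
  -- `s`, so `gradSq G s` is positive on it.
  let A : Set E := Metric.closedBall c R \ Metric.ball c δ
  have hA : IsCompact A := (isCompact_closedBall c R).diff Metric.isOpen_ball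
  have hAR : A ⊆ Metric.closedBall c R := Set.sdiff_subset
  have hds : ∀ x ∈ A, fderiv ℝ s x ≠ 0 := fun x hx h => by
    have h1 : HasFDerivAt s (2 • (innerSL ℝ (x - c)).comp (.id ℝ E)) x :=
      ((hasFDerivAt_id x).sub_const c).norm_sq
    have h2 := DFunLike.congr_fun (h1.fderiv.symm.trans h) (x - c)
    have h3 : x - c = 0 := by simpa [-map_sub] using h2
    refine hx.2 ?_
    rw [sub_eq_zero.1 h3]
    exact Metric.mem_ball_self hδ
  have hgs : ∀ x ∈ A, 0 < gradSq G s x := fun x hx =>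
    gradSq_pos (hG x (hAR hx)).isInvertible (hpos x (hAR hx)) (hds x hx)
  -- A strength `α` above this quotient makes the barrier a strict subsolution of the operator
  -- linearized at `U`; compactness of the annulus bounds it.
  let q : E → ℝ := fun x => (laplacian G s x +
    b / a * fderiv ℝ s x ((G x).inverse (fderiv ℝ U x))) / gradSq G s x
  have hq : ContinuousOn q A := fun x hx => by
    have hx' := hAR hx
    refine (ContinuousAt.div₀ ?_ ?_ (hgs x hx).ne').continuousWithinAt
    · exact (continuousAt_laplacian (hG x hx') (hs x)).add
        (continuousAt_const.mul (continuousAt_inverse_apply (hG x hx') (hs x) (hU x hx')))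
    · exact continuousAt_inverse_apply (hG x hx') (hs x) (hs x)
  obtain ⟨C, hC⟩ := (hA.image_of_continuousOn hq).bddAbove
  obtain ⟨α, hα⟩ : ∃ α, max C 0 < α := exists_gt _
  have hα0 : 0 < α := (le_max_right _ _).trans_lt hα
  have hαs : ∀ x ∈ A, laplacian G s x + b / a * fderiv ℝ s x ((G x).inverse (fderiv ℝ U x)) <
      α * gradSq G s x := fun x hx => by
    rw [← div_lt_iff₀ (hgs x hx)]
    exact ((hC ⟨x, hx, rfl⟩).trans (le_max_left _ _)).trans_lt hα
  obtain ⟨x₁, hx₁, hmax₁⟩ := (isCompact_closedBall c δ).exists_isMaxOn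
    (Metric.nonempty_closedBall.2 hδ.le) (f := U) fun x hx =>
      (hU x (Metric.closedBall_subset_closedBall hδR.le hx)).continuousAt.continuousWithinAt
  -- The gap below `K` on the inner ball: since the barrier is at most `ε`, adding it there keeps `U
  -- + h` at most `K`.
  let ε : ℝ := K - U x₁
  have hε : 0 < ε := sub_pos.2 (hδK x₁ hx₁)
  let h : E → ℝ := fun x => ε * (Real.exp (-(α * s x)) - Real.exp (-(α * R ^ 2)))
  have hh : ∀ x, ContDiffAt ℝ 2 h x := fun x =>
    contDiffAt_const.mul ((contDiffAt_const.mul (hs x)).neg.exp.sub contDiffAt_const)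
  have hw : ∀ x ∈ A, ContDiffAt ℝ 2 (fun x => U x + h x) x := fun x hx =>
    (hU x (hAR hx)).add (hh x)
  obtain ⟨x₂, hx₂, hmax₂⟩ := hA.exists_isMaxOn
    ⟨z, Metric.ball_subset_closedBall hz, by simpa using hzδ.le⟩
    (f := fun x => U x + h x) fun x hx => (hw x hx).continuousAt.continuousWithinAt
  have hsdist : ∀ x, s x = dist x c ^ 2 := fun x => by
    simp only [s]
    rw [dist_eq_norm]
  -- The maximum of `U + h` lies on the outer sphere, where `h = 0`, or on the inner one, where `ε`
  -- leaves room. An interior maximum contradicts strictness.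
  have key : U x₂ + h x₂ ≤ K := by
    rcases (Metric.mem_closedBall.1 hx₂.1).eq_or_lt with hR₂ | hR₂
    · have h0 : h x₂ = 0 := by simp [h, hsdist, hR₂]
      rw [h0, add_zero]
      exact hle x₂ (hAR hx₂)
    rcases (not_lt.1 (fun h => hx₂.2 h) : δ ≤ dist x₂ c).eq_or_lt with hδ₂ | hδ₂
    · have h1 : U x₂ ≤ U x₁ := hmax₁ (Metric.mem_closedBall.2 hδ₂.ge)
      have h2 : Real.exp (-(α * s x₂)) ≤ 1 := by
        rw [Real.exp_le_one_iff, hsdist]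
        have := mul_nonneg hα0.le (sq_nonneg (dist x₂ c))
        linarith
      have h3 := Real.exp_pos (-(α * R ^ 2))
      have h4 : h x₂ ≤ ε * 1 := mul_le_mul_of_nonneg_left (by linarith) hε.le
      have h5 : ε = K - U x₁ := rfl
      linarith
    · exfalso
      have hnhds : A ∈ 𝓝 x₂ := by
        have h1 : Metric.ball c R ∩ (Metric.closedBall c δ)ᶜ ∈ 𝓝 x₂ :=
          (Metric.isOpen_ball.inter Metric.isClosed_closedBall.isOpen_compl).mem_nhds
            ⟨hR₂, by simpa using hδ₂⟩
        exact mem_of_superset h1 fun x hx =>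
          ⟨Metric.ball_subset_closedBall hx.1, fun hx' => hx.2 (Metric.ball_subset_closedBall hx')⟩
      have hloc : IsLocalMax (fun x => U x + h x) x₂ := hmax₂.isLocalMax hnhds
      have hx₂' := hAR hx₂
      have h1 := laplacian_nonpos_of_isLocalMax (hG x₂ hx₂') (hpos x₂ hx₂') (hw x₂ hx₂) hloc
      rw [laplacian_add (hU x₂ hx₂') (hh x₂), laplacian_barrier (hs x₂)] at h1
      -- At a critical point of `U + h` one factor `dU` in the quadratic gradient term can be
      -- replaced by a multiple of `ds`. This gives the linear term controlled by `q`, whatever the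
      -- sign of `b`.
      have h2 : fderiv ℝ U x₂ = (ε * α * Real.exp (-(α * s x₂))) • fderiv ℝ s x₂ := by
        have h3 := hloc.fderiv_eq_zero
        have hd := (hs x₂).differentiableAt (by norm_num : (2 : ℕ∞ω) ≠ 0)
        have h4 : HasFDerivAt h _ x₂ := ((((hd.hasFDerivAt.const_mul α).fun_neg.exp).sub_const
          (Real.exp (-(α * R ^ 2)))).const_mul ε)
        rw [fderiv_fun_add ((hU x₂ hx₂').differentiableAt (by norm_num)) h4.differentiableAt,
          h4.fderiv] at h3
        rw [eq_neg_of_add_eq_zero_left h3]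
        ext v
        simp
        ring
      have h3 : gradSq G U x₂ = ε * α * Real.exp (-(α * s x₂)) *
          fderiv ℝ s x₂ ((G x₂).inverse (fderiv ℝ U x₂)) := by
        rw [gradSq]
        conv_lhs => rw [DFunLike.congr_fun h2]
        rfl
      have h4 := hL x₂ hx₂'
      rw [h3] at h4
      have h5 := hαs x₂ hx₂
      have h6 : 0 < ε * α * Real.exp (-(α * s x₂)) := by positivity
      have h7 := mul_pos h6 (sub_pos.2 h5)
      have h8 : laplacian G U x₂ = (a * laplacian G U x₂) / a := by field_simp
      have h9 : 0 ≤ (a * laplacian G U x₂ + b * (ε * α * Real.exp (-(α * s x₂)) *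
          fderiv ℝ s x₂ ((G x₂).inverse (fderiv ℝ U x₂)))) / a := div_nonneg h4 ha.le
      have h10 : (a * laplacian G U x₂ + b * (ε * α * Real.exp (-(α * s x₂)) *
          fderiv ℝ s x₂ ((G x₂).inverse (fderiv ℝ U x₂)))) / a = laplacian G U x₂ +
          ε * α * Real.exp (-(α * s x₂)) * (b / a *
            fderiv ℝ s x₂ ((G x₂).inverse (fderiv ℝ U x₂))) := by
        field_simp
      rw [h10] at h9
      nlinarith
  have hzA : z ∈ A := ⟨Metric.ball_subset_closedBall hz, by simpa using hzδ.le⟩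
  have h1 : U z + h z ≤ K := (hmax₂ hzA).trans key
  have h2 : 0 < h z := by
    refine mul_pos hε (sub_pos.2 (Real.exp_lt_exp.2 ?_))
    rw [hsdist, neg_lt_neg_iff]
    exact mul_lt_mul_of_pos_left (pow_lt_pow_left₀ hz dist_nonneg two_ne_zero) hα0
  linarith

end MaximumPrinciple

end Multiconformal

namespace Multiconformal

open Filter Topology Bundle

/-! ### Metrics and Laplacians in the charts of a manifold -/

section Charts

variable {E : Type*} [NormedAddCommGroup E] [NormedSpace ℝ E]
  {M : Type*} [TopologicalSpace M] [ChartedSpace E M]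

/-- The Laplacian at `q` of a function on a manifold. -/
def manifoldLaplacian (g : BilinField 𝓘(ℝ, E) (M := M)) (u : M → ℝ) (q : M) : ℝ :=
  laplacian (inChart g q) (u ∘ (extChartAt 𝓘(ℝ, E) q).symm) (extChartAt 𝓘(ℝ, E) q q)

/-- The squared norm at `q` of the gradient of a function on a manifold. -/
def manifoldGradSq (g : BilinField 𝓘(ℝ, E) (M := M)) (u : M → ℝ) (q : M) : ℝ :=
  gradSq (inChart g q) (u ∘ (extChartAt 𝓘(ℝ, E) q).symm) (extChartAt 𝓘(ℝ, E) q q)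

theorem manifoldLaplacian_const (g : BilinField 𝓘(ℝ, E) (M := M)) (c : ℝ) (q : M) :
    manifoldLaplacian g (fun _ => c) q = 0 := by
  have h : hessian (inChart g q) (fun _ => c) (extChartAt 𝓘(ℝ, E) q q) = 0 := by
    ext v w
    simp [hessian_apply]
  rw [manifoldLaplacian, Function.comp_def, laplacian, h]
  simp [metricTrace]

theorem manifoldGradSq_const (g : BilinField 𝓘(ℝ, E) (M := M)) (c : ℝ) (q : M) :
    manifoldGradSq g (fun _ => c) q = 0 := by
  simp [manifoldGradSq, gradSq, Function.comp_def]

variable [IsManifold 𝓘(ℝ, E) ∞ M] {p q : M} {y : E}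

theorem target_mem_nhds (hy : y ∈ (extChartAt 𝓘(ℝ, E) p).target) :
    (extChartAt 𝓘(ℝ, E) p).target ∈ 𝓝 y :=
  (isOpen_extChartAt_target p).mem_nhds hy

theorem contMDiffAt_chart_symm (hy : y ∈ (extChartAt 𝓘(ℝ, E) p).target) :
    ContMDiffAt 𝓘(ℝ, E) 𝓘(ℝ, E) ∞ (extChartAt 𝓘(ℝ, E) p).symm y :=
  (contMDiffOn_extChartAt_symm p).contMDiffAt (target_mem_nhds hy)

theorem isInvertible_mfderiv_chart_symm (hy : y ∈ (extChartAt 𝓘(ℝ, E) p).target) :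
    (mfderiv 𝓘(ℝ, E) 𝓘(ℝ, E) (extChartAt 𝓘(ℝ, E) p).symm y).IsInvertible := by
  have : IsManifold 𝓘(ℝ, E) 1 M := .of_le (n := ∞) (by simp)
  have h := isInvertible_mfderivWithin_extChartAt_symm hy
  rwa [modelWithCornersSelf_coe, Set.range_id, mfderivWithin_univ] at h

theorem contDiffAt_comp_chart_symm {u : M → ℝ} (hu : ContMDiff 𝓘(ℝ, E) 𝓘(ℝ, ℝ) ∞ u)
    (hy : y ∈ (extChartAt 𝓘(ℝ, E) p).target) :
    ContDiffAt ℝ ∞ (u ∘ (extChartAt 𝓘(ℝ, E) p).symm) y := by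
  rw [← contMDiffAt_iff_contDiffAt]
  exact hu.contMDiffAt.comp y (contMDiffAt_chart_symm hy)

/-- The tangent map of the inverse chart carries constant vectors to smooth sections, and a smooth
metric applied to smooth sections is smooth. -/
theorem contDiffAt_inChart_apply
    (g : ContMDiffRiemannianMetric 𝓘(ℝ, E) ∞ E (fun x : M => TangentSpace 𝓘(ℝ, E) x))
    (hy : y ∈ (extChartAt 𝓘(ℝ, E) p).target) (v w : E) :
    ContDiffAt ℝ ∞ (fun z => inChart g.inner p z v w) y := by
  rw [← contMDiffAt_iff_contDiffAt]
  have : IsManifold 𝓘(ℝ, E) 1 M := .of_le (n := ∞) (by simp)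
  set T := (extChartAt 𝓘(ℝ, E) p).target with hT
  have hopen : IsOpen T := isOpen_extChartAt_target p
  have hv : ∀ v : E, ContMDiffAt 𝓘(ℝ, E) (𝓘(ℝ, E).prod 𝓘(ℝ, E)) ∞
      (fun z : E => TotalSpace.mk' E (E := fun x : M => TangentSpace 𝓘(ℝ, E) x)
        ((extChartAt 𝓘(ℝ, E) p).symm z)
        (mfderiv 𝓘(ℝ, E) 𝓘(ℝ, E) (extChartAt 𝓘(ℝ, E) p).symm z v)) y := fun v => by
    have h1 := (contMDiffOn_extChartAt_symm (I := 𝓘(ℝ, E)) (n := ∞) p).contMDiffOn_tangentMapWithin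
      (m := ∞) (by simp) hopen.uniqueMDiffOn
    have h2 : ContMDiff 𝓘(ℝ, E) (𝓘(ℝ, E).prod 𝓘(ℝ, E)) ∞
        (fun z : E => (⟨z, v⟩ : TangentBundle 𝓘(ℝ, E) E)) := by
      exact contMDiff_vectorSpace_iff_contDiff.2 contDiff_const
    have h3 := (h1.contMDiffAt (x := (⟨y, v⟩ : TangentBundle 𝓘(ℝ, E) E))
      ((hopen.preimage (FiberBundle.continuous_proj E _)).mem_nhds hy)).comp y h2.contMDiffAt
    refine h3.congr_of_eventuallyEq ?_
    filter_upwards [hopen.mem_nhds hy] with z hz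
    simp only [Function.comp_apply, tangentMapWithin]
    rw [← hT, mfderivWithin_of_mem_nhds (hopen.mem_nhds hz)]
  have h4 : ContMDiffAt 𝓘(ℝ, E) (𝓘(ℝ, E).prod 𝓘(ℝ)) ∞
      (fun z => TotalSpace.mk' ℝ (E := Bundle.Trivial M ℝ) ((extChartAt 𝓘(ℝ, E) p).symm z)
        (inChart g.inner p z v w)) y := by
    apply ContMDiffAt.clm_bundle_apply₂ (F₁ := E) (F₂ := E)
    · exact g.contMDiff.contMDiffAt.comp y (contMDiffAt_chart_symm hy)
    · exact hv v
    · exact hv w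
  rw [contMDiffAt_totalSpace] at h4
  exact h4.2

/-- The coordinate change from the chart at `q` to the chart at `p`. -/
def chartChange (p q : M) : E → E :=
  extChartAt 𝓘(ℝ, E) p ∘ (extChartAt 𝓘(ℝ, E) q).symm

theorem chartChange_eventually (hy : y ∈ (extChartAt 𝓘(ℝ, E) q).target)
    (hp : (extChartAt 𝓘(ℝ, E) q).symm y ∈ (extChartAt 𝓘(ℝ, E) p).source) :
    ∀ᶠ z in 𝓝 y, z ∈ (extChartAt 𝓘(ℝ, E) q).target ∧
      (extChartAt 𝓘(ℝ, E) q).symm z ∈ (extChartAt 𝓘(ℝ, E) p).source :=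
  Filter.Eventually.and (target_mem_nhds hy)
    ((contMDiffAt_chart_symm hy).continuousAt.eventually
      ((isOpen_extChartAt_source p).mem_nhds hp))

theorem contDiffAt_chartChange (hy : y ∈ (extChartAt 𝓘(ℝ, E) q).target)
    (hp : (extChartAt 𝓘(ℝ, E) q).symm y ∈ (extChartAt 𝓘(ℝ, E) p).source) :
    ContDiffAt ℝ ∞ (chartChange p q : E → E) y := by
  rw [← contMDiffAt_iff_contDiffAt]
  exact (contMDiffAt_extChartAt' (by rwa [extChartAt_source] at hp)).comp y
    (contMDiffAt_chart_symm hy)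

theorem chartChange_mem_target
    (hp : (extChartAt 𝓘(ℝ, E) q).symm y ∈ (extChartAt 𝓘(ℝ, E) p).source) :
    (chartChange p q y : E) ∈ (extChartAt 𝓘(ℝ, E) p).target :=
  (extChartAt 𝓘(ℝ, E) p).map_source hp

theorem mfderiv_chart_symm_eq (hy : y ∈ (extChartAt 𝓘(ℝ, E) q).target)
    (hp : (extChartAt 𝓘(ℝ, E) q).symm y ∈ (extChartAt 𝓘(ℝ, E) p).source) (v : E) :
    (mfderiv 𝓘(ℝ, E) 𝓘(ℝ, E) (extChartAt 𝓘(ℝ, E) q).symm y v : E) =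
      mfderiv 𝓘(ℝ, E) 𝓘(ℝ, E) (extChartAt 𝓘(ℝ, E) p).symm (chartChange p q y)
        (fderiv ℝ (chartChange p q) y v) := by
  have h1 : (extChartAt 𝓘(ℝ, E) q).symm =ᶠ[𝓝 y]
      (extChartAt 𝓘(ℝ, E) p).symm ∘ chartChange p q := by
    filter_upwards [chartChange_eventually hy hp] with z hz
    exact ((extChartAt 𝓘(ℝ, E) p).left_inv hz.2).symm
  have h2 := (contMDiffAt_chart_symm (chartChange_mem_target hp)).mdifferentiableAt (by simp)
  have h3 := (contDiffAt_chartChange hy hp).differentiableAt (by simp)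
  have h4 := h2.hasMFDerivAt.comp y h3.hasFDerivAt.hasMFDerivAt
  rw [(h4.congr_of_eventuallyEq h1).mfderiv]
  rfl

theorem inChart_eq_pullback (g : BilinField 𝓘(ℝ, E) (M := M))
    (hy : y ∈ (extChartAt 𝓘(ℝ, E) q).target)
    (hp : (extChartAt 𝓘(ℝ, E) q).symm y ∈ (extChartAt 𝓘(ℝ, E) p).source) :
    inChart g q y = pullback (fderiv ℝ (chartChange p q) y) (inChart g p (chartChange p q y)) := by
  -- The fibre type depends on the base point, so rewriting the point is done with all tangent
  -- spaces read as `E`.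
  have key : ∀ x x' : M, x = x' → ∀ a b : E, (g x : E →L[ℝ] E →L[ℝ] ℝ) a b =
      (g x' : E →L[ℝ] E →L[ℝ] ℝ) a b := by
    rintro x _ rfl a b
    rfl
  ext v w
  rw [pullback_apply, inChart_apply, inChart_apply, mfderiv_chart_symm_eq hy hp,
    mfderiv_chart_symm_eq hy hp]
  exact key _ _ ((extChartAt 𝓘(ℝ, E) p).left_inv hp).symm _ _

theorem isInvertible_fderiv_chartChange (hy : y ∈ (extChartAt 𝓘(ℝ, E) q).target)
    (hp : (extChartAt 𝓘(ℝ, E) q).symm y ∈ (extChartAt 𝓘(ℝ, E) p).source) :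
    (fderiv ℝ (chartChange p q : E → E) y).IsInvertible := by
  have hz := chartChange_mem_target hp
  have h : (extChartAt 𝓘(ℝ, E) p).symm (chartChange p q y) =
      (extChartAt 𝓘(ℝ, E) q).symm y := (extChartAt 𝓘(ℝ, E) p).left_inv hp
  have hq : (extChartAt 𝓘(ℝ, E) p).symm (chartChange p q y) ∈ (extChartAt 𝓘(ℝ, E) q).source := by
    rw [h]
    exact (extChartAt 𝓘(ℝ, E) q).map_target hy
  have hback : chartChange q p (chartChange p q y : E) = y := by
    change extChartAt 𝓘(ℝ, E) q ((extChartAt 𝓘(ℝ, E) p).symm (chartChange p q y)) = y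
    rw [h, (extChartAt 𝓘(ℝ, E) q).right_inv hy]
  have hd1 := ((contDiffAt_chartChange hy hp).differentiableAt (by simp)).hasFDerivAt
  have hd2 := ((contDiffAt_chartChange hz hq).differentiableAt (by simp)).hasFDerivAt
  have h1 : chartChange q p ∘ chartChange p q =ᶠ[𝓝 y] (id : E → E) := by
    filter_upwards [chartChange_eventually hy hp] with z hz
    change extChartAt 𝓘(ℝ, E) q ((extChartAt 𝓘(ℝ, E) p).symm
      (extChartAt 𝓘(ℝ, E) p ((extChartAt 𝓘(ℝ, E) q).symm z))) = z
    rw [(extChartAt 𝓘(ℝ, E) p).left_inv hz.2, (extChartAt 𝓘(ℝ, E) q).right_inv hz.1]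
  have h2 : chartChange p q ∘ chartChange q p =ᶠ[𝓝 (chartChange p q y)] (id : E → E) := by
    filter_upwards [chartChange_eventually hz hq] with z hz
    change extChartAt 𝓘(ℝ, E) p ((extChartAt 𝓘(ℝ, E) q).symm
      (extChartAt 𝓘(ℝ, E) q ((extChartAt 𝓘(ℝ, E) p).symm z))) = z
    rw [(extChartAt 𝓘(ℝ, E) q).left_inv hz.2, (extChartAt 𝓘(ℝ, E) p).right_inv hz.1]
  have hd1' : HasFDerivAt (chartChange p q : E → E) (fderiv ℝ (chartChange p q) y)
      (chartChange q p (chartChange p q y)) := by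
    rw [hback]
    exact hd1
  exact .of_inverse
    ((hd1'.comp _ hd2).unique ((hasFDerivAt_id _).congr_of_eventuallyEq h2))
    ((hd2.comp _ hd1).unique ((hasFDerivAt_id _).congr_of_eventuallyEq h1))

variable [FiniteDimensional ℝ E]

theorem contDiffAt_inChart
    (g : ContMDiffRiemannianMetric 𝓘(ℝ, E) ∞ E (fun x : M => TangentSpace 𝓘(ℝ, E) x))
    (hy : y ∈ (extChartAt 𝓘(ℝ, E) p).target) : ContDiffAt ℝ ∞ (inChart g.inner p) y := by
  rw [← contDiffWithinAt_univ]
  have h : ContDiffOn ℝ ∞ (inChart g.inner p) (extChartAt 𝓘(ℝ, E) p).target := by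
    rw [contDiffOn_clm_apply]
    intro v
    rw [contDiffOn_clm_apply]
    exact fun w z hz => (contDiffAt_inChart_apply g hz v w).contDiffWithinAt
  exact (h.contDiffAt (target_mem_nhds hy)).contDiffWithinAt

theorem inChart_pos
    (g : ContMDiffRiemannianMetric 𝓘(ℝ, E) ∞ E (fun x : M => TangentSpace 𝓘(ℝ, E) x))
    (hy : y ∈ (extChartAt 𝓘(ℝ, E) p).target) {v : E} (hv : v ≠ 0) :
    0 < inChart g.inner p y v v := by
  rw [inChart_apply]
  refine g.pos _ _ fun h => hv ?_
  exact (isInvertible_mfderiv_chart_symm hy).injective (h.trans (map_zero _).symm)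

theorem isInvertible_of_pos {g : E →L[ℝ] E →L[ℝ] ℝ} (hg : ∀ v, v ≠ 0 → 0 < g v v) :
    g.IsInvertible := by
  have hinj : Function.Injective (g : E →ₗ[ℝ] E →L[ℝ] ℝ) := by
    rw [← LinearMap.ker_eq_bot, LinearMap.ker_eq_bot']
    intro v hv
    by_contra hne
    have h := hg v hne
    rw [show g v = 0 from hv] at h
    exact lt_irrefl _ h
  have hdim : Module.finrank ℝ E = Module.finrank ℝ (E →L[ℝ] ℝ) := by
    rw [← (LinearMap.toContinuousLinearMap (𝕜 := ℝ) (E := E) (F' := ℝ)).finrank_eq]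
    exact Subspace.dual_finrank_eq.symm
  exact ⟨(LinearEquiv.ofInjectiveOfFinrankEq _ hinj hdim).toContinuousLinearEquiv, rfl⟩

theorem isMetricAt_inChart
    (g : ContMDiffRiemannianMetric 𝓘(ℝ, E) ∞ E (fun x : M => TangentSpace 𝓘(ℝ, E) x))
    (hy : y ∈ (extChartAt 𝓘(ℝ, E) p).target) : IsMetricAt (inChart g.inner p) y where
  contDiffAt := (contDiffAt_inChart g hy).of_le (by norm_cast)
  symm := .of_forall fun z v w => g.symm _ _ _
  isInvertible := isInvertible_of_pos fun _ hv => inChart_pos g hy hv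

/-- `manifoldLaplacian` uses a different chart at each point, whereas the maximum principle on a
ball needs one chart throughout; the coordinate invariance above bridges the two. -/
theorem laplacian_inChart_eq
    (g : ContMDiffRiemannianMetric 𝓘(ℝ, E) ∞ E (fun x : M => TangentSpace 𝓘(ℝ, E) x))
    {u : M → ℝ} (hu : ContMDiff 𝓘(ℝ, E) 𝓘(ℝ, ℝ) ∞ u) (hy : y ∈ (extChartAt 𝓘(ℝ, E) p).target) :
    laplacian (inChart g.inner p) (u ∘ (extChartAt 𝓘(ℝ, E) p).symm) y =
        manifoldLaplacian g.inner u ((extChartAt 𝓘(ℝ, E) p).symm y) ∧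
      gradSq (inChart g.inner p) (u ∘ (extChartAt 𝓘(ℝ, E) p).symm) y =
        manifoldGradSq g.inner u ((extChartAt 𝓘(ℝ, E) p).symm y) := by
  set q := (extChartAt 𝓘(ℝ, E) p).symm y with hq
  have hyq : extChartAt 𝓘(ℝ, E) q q ∈ (extChartAt 𝓘(ℝ, E) q).target := mem_extChartAt_target q
  have hp : (extChartAt 𝓘(ℝ, E) q).symm (extChartAt 𝓘(ℝ, E) q q) ∈
      (extChartAt 𝓘(ℝ, E) p).source := by
    rw [extChartAt_to_inv]
    exact (extChartAt 𝓘(ℝ, E) p).map_target hy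
  have hΦy : chartChange p q (extChartAt 𝓘(ℝ, E) q q) = y := by
    change extChartAt 𝓘(ℝ, E) p ((extChartAt 𝓘(ℝ, E) q).symm (extChartAt 𝓘(ℝ, E) q q)) = y
    rw [extChartAt_to_inv, hq, (extChartAt 𝓘(ℝ, E) p).right_inv hy]
  have hG : IsMetricAt (inChart g.inner p) (chartChange p q (extChartAt 𝓘(ℝ, E) q q)) :=
    isMetricAt_inChart g (chartChange_mem_target hp)
  have hG' := isMetricAt_inChart g hyq
  have hΦ : ContDiffAt ℝ 2 (chartChange p q : E → E) (extChartAt 𝓘(ℝ, E) q q) :=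
    (contDiffAt_chartChange hyq hp).of_le (by norm_cast)
  have hD := isInvertible_fderiv_chartChange hyq hp
  have hev := chartChange_eventually hyq hp
  have h : inChart g.inner q =ᶠ[𝓝 (extChartAt 𝓘(ℝ, E) q q)] fun z =>
      pullback (fderiv ℝ (chartChange p q) z) (inChart g.inner p (chartChange p q z)) := by
    filter_upwards [hev] with z hz using inChart_eq_pullback g.inner hz.1 hz.2
  have hU : ContDiffAt ℝ 2 (u ∘ (extChartAt 𝓘(ℝ, E) p).symm)
      (chartChange p q (extChartAt 𝓘(ℝ, E) q q)) :=
    (contDiffAt_comp_chart_symm hu (chartChange_mem_target hp)).of_le (by norm_cast)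
  have hU' : u ∘ (extChartAt 𝓘(ℝ, E) q).symm =ᶠ[𝓝 (extChartAt 𝓘(ℝ, E) q q)]
      (u ∘ (extChartAt 𝓘(ℝ, E) p).symm) ∘ chartChange p q := by
    filter_upwards [hev] with z hz
    exact congrArg u ((extChartAt 𝓘(ℝ, E) p).left_inv hz.2).symm
  rw [manifoldLaplacian, manifoldGradSq, laplacian_pullback hG hG' hΦ hD h hU hU',
    gradSq_pullback hG hG' hΦ hD h hU hU', hΦy]
  exact ⟨rfl, rfl⟩

theorem isLocalMax_comp_chart_symm {u : M → ℝ} (hq : IsLocalMax u q) :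
    IsLocalMax (u ∘ (extChartAt 𝓘(ℝ, E) q).symm) (extChartAt 𝓘(ℝ, E) q q) := by
  have hc := (contMDiffAt_chart_symm (mem_extChartAt_target (I := 𝓘(ℝ, E)) q)).continuousAt
  rw [← extChartAt_to_inv (I := 𝓘(ℝ, E)) q] at hq
  exact IsMaxFilter.comp_tendsto hq hc

theorem manifoldLaplacian_nonpos
    (g : ContMDiffRiemannianMetric 𝓘(ℝ, E) ∞ E (fun x : M => TangentSpace 𝓘(ℝ, E) x))
    {u : M → ℝ} (hu : ContMDiff 𝓘(ℝ, E) 𝓘(ℝ, ℝ) ∞ u) (hq : IsLocalMax u q) :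
    manifoldLaplacian g.inner u q ≤ 0 :=
  laplacian_nonpos_of_isLocalMax (isMetricAt_inChart g (mem_extChartAt_target q))
    (fun _ hv => inChart_pos g (mem_extChartAt_target q) hv)
    ((contDiffAt_comp_chart_symm hu (mem_extChartAt_target q)).of_le (by norm_cast))
    (isLocalMax_comp_chart_symm hq)

theorem manifoldGradSq_eq_zero (g : BilinField 𝓘(ℝ, E) (M := M)) {u : M → ℝ}
    (hq : IsLocalMax u q) : manifoldGradSq g u q = 0 :=
  gradSq_eq_zero_of_isLocalMax (isLocalMax_comp_chart_symm hq)

end Charts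

/-- The strong maximum principle on a closed connected manifold. -/
theorem exists_eq_const_of_subsolution {E : Type*} [NormedAddCommGroup E] [InnerProductSpace ℝ E]
    [FiniteDimensional ℝ E] {M : Type*} [TopologicalSpace M] [ChartedSpace E M]
    [IsManifold 𝓘(ℝ, E) ∞ M] [CompactSpace M] [ConnectedSpace M]
    (g : ContMDiffRiemannianMetric 𝓘(ℝ, E) ∞ E (fun x : M => TangentSpace 𝓘(ℝ, E) x))
    {u : M → ℝ} (hu : ContMDiff 𝓘(ℝ, E) 𝓘(ℝ, ℝ) ∞ u) {a b : ℝ} (ha : 0 < a)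
    (h : ∀ q, 0 ≤ a * manifoldLaplacian g.inner u q + b * manifoldGradSq g.inner u q) :
    ∃ c, ∀ q, u q = c := by
  obtain ⟨x₀, -, hmax⟩ := isCompact_univ.exists_isMaxOn Set.univ_nonempty hu.continuous.continuousOn
  have hle : ∀ x, u x ≤ u x₀ := fun x => hmax (Set.mem_univ x)
  let S : Set M := {x | u x = u x₀}
  have hclosed : IsClosed S := isClosed_eq hu.continuous continuous_const
  -- If `x` near a maximum point `p` had a smaller value, a ball around `x` containing `p` would
  -- force the value at `p` below the maximum.
  have hopen : IsOpen S := by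
    rw [isOpen_iff_mem_nhds]
    intro p hp
    obtain ⟨R, hR, hball⟩ := Metric.nhds_basis_closedBall.mem_iff.1
      (target_mem_nhds (mem_extChartAt_target (I := 𝓘(ℝ, E)) p))
    have h1 : ∀ᶠ x in 𝓝 p, x ∈ (extChartAt 𝓘(ℝ, E) p).source ∧
        extChartAt 𝓘(ℝ, E) p x ∈ Metric.ball (extChartAt 𝓘(ℝ, E) p p) (R / 2) :=
      Filter.Eventually.and (extChartAt_source_mem_nhds p)
        ((continuousAt_extChartAt p).eventually (Metric.ball_mem_nhds _ (by positivity)))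
    filter_upwards [h1] with x hx
    by_contra hne
    set c := extChartAt 𝓘(ℝ, E) p x with hc
    -- Halving `R` keeps the ball around `c` inside the chart while it still contains the image of
    -- `p`.
    have hsub : Metric.closedBall c (R / 2) ⊆ (extChartAt 𝓘(ℝ, E) p).target := by
      refine Set.Subset.trans (Metric.closedBall_subset_closedBall' ?_) hball
      have := Metric.mem_ball.1 hx.2
      linarith
    have hcx : (extChartAt 𝓘(ℝ, E) p).symm c = x := (extChartAt 𝓘(ℝ, E) p).left_inv hx.1
    have h2 := lt_of_subsolution (G := inChart g.inner p)
      (U := u ∘ (extChartAt 𝓘(ℝ, E) p).symm) (c := c) (R := R / 2) (K := u x₀) (a := a) (b := b)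
      (fun z hz => isMetricAt_inChart g (hsub hz))
      (fun z hz v hv => inChart_pos g (hsub hz) hv)
      (fun z hz => (contDiffAt_comp_chart_symm hu (hsub hz)).of_le (by norm_cast)) ha
      (fun z hz => by
        rw [(laplacian_inChart_eq g hu (hsub hz)).1, (laplacian_inChart_eq g hu (hsub hz)).2]
        exact h _)
      (fun z _ => hle _)
      (by
        rw [Function.comp_apply, hcx]
        exact lt_of_le_of_ne (hle x) hne)
      (extChartAt 𝓘(ℝ, E) p p) (Metric.mem_ball_comm.1 hx.2)
    rw [Function.comp_apply, extChartAt_to_inv] at h2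
    exact h2.ne hp
  have huniv := IsClopen.eq_univ ⟨hclosed, hopen⟩ ⟨x₀, rfl⟩
  exact ⟨u x₀, fun q => huniv.ge (Set.mem_univ q)⟩

end Multiconformal

namespace Multiconformal

open Filter Topology Bundle

/-! ### Locality of the scalar curvature -/

section Congr

variable {E : Type*} [NormedAddCommGroup E] [NormedSpace ℝ E] [FiniteDimensional ℝ E]

theorem coordScalarCurvature_congr {G G' : E → E →L[ℝ] E →L[ℝ] ℝ} {y : E} (h : G =ᶠ[𝓝 y] G') :
    coordScalarCurvature G y = coordScalarCurvature G' y := by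
  have h1 : christoffel G =ᶠ[𝓝 y] christoffel G' := by
    filter_upwards [h.eventuallyEq_nhds] with z hz
    rw [christoffel, christoffel, koszul, koszul, hz.fderiv_eq, hz.self_of_nhds]
  have h2 : curvature G y = curvature G' y := by
    ext v w u
    simp only [curvature, LinearMap.coe_mk, AddHom.coe_mk, h1.fderiv_eq, h1.self_of_nhds]
  have h3 : ricci G y = ricci G' y := by
    ext v w
    simp only [ricci, LinearMap.coe_mk, AddHom.coe_mk, h2]
  have h4 : ricciSharp G y = ricciSharp G' y := by
    ext v
    simp only [ricciSharp, LinearMap.coe_mk, AddHom.coe_mk, h3, h.self_of_nhds]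
  rw [coordScalarCurvature, coordScalarCurvature, h4]

end Congr

/-! ### The multiconformal metric in product charts -/

section ProductCharts

variable {ι : Type*} [Fintype ι] {E : ι → Type*} [∀ i, NormedAddCommGroup (E i)]
  [∀ i, NormedSpace ℝ (E i)] {M : ι → Type*} [∀ i, TopologicalSpace (M i)]
  [∀ i, ChartedSpace (E i) (M i)] {p : ∀ i, M i} {y : ∀ i, E i}

theorem extChartAt_pi_apply (x : ∀ i, M i) (i : ι) :
    extChartAt (ModelWithCorners.pi fun i => 𝓘(ℝ, E i)) p x i =
      extChartAt 𝓘(ℝ, E i) (p i) (x i) := rfl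

theorem extChartAt_pi_symm_apply (i : ι) :
    (extChartAt (ModelWithCorners.pi fun i => 𝓘(ℝ, E i)) p).symm y i =
      (extChartAt 𝓘(ℝ, E i) (p i)).symm (y i) := rfl

theorem range_pi_model :
    Set.range (ModelWithCorners.pi fun i => 𝓘(ℝ, E i)) = Set.univ :=
  Set.range_eq_univ.2 fun y => ⟨y, rfl⟩

theorem eventually_mem_target (h : ∀ i, y i ∈ (extChartAt 𝓘(ℝ, E i) (p i)).target) :
    ∀ᶠ z in 𝓝 y, ∀ i, z i ∈ (extChartAt 𝓘(ℝ, E i) (p i)).target :=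
  eventually_all.2 fun i => (continuous_apply i).continuousAt.eventually
    ((isOpen_extChartAt_target (p i)).mem_nhds (h i))

theorem mfderiv_eval (x : ∀ i, M i) (i : ι) (v : ∀ i, E i) :
    (mfderiv (ModelWithCorners.pi fun i => 𝓘(ℝ, E i)) 𝓘(ℝ, E i) (fun z : ∀ j, M j => z i) x v :
      E i) = v i := by
  have h : HasMFDerivAt (ModelWithCorners.pi fun i => 𝓘(ℝ, E i)) 𝓘(ℝ, E i)
      (fun z : ∀ j, M j => z i) x (ContinuousLinearMap.proj (R := ℝ) (φ := E) i) := by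
    have h1 : HasFDerivAt (fun z : ∀ i, E i => extChartAt 𝓘(ℝ, E i) (x i)
        ((extChartAt 𝓘(ℝ, E i) (x i)).symm (z i)))
        (ContinuousLinearMap.proj (R := ℝ) (φ := E) i)
        (extChartAt (ModelWithCorners.pi fun i => 𝓘(ℝ, E i)) x x) := by
      refine (ContinuousLinearMap.proj (R := ℝ) (φ := E) i).hasFDerivAt.congr_of_eventuallyEq ?_
      filter_upwards [eventually_mem_target (p := x)
        (y := extChartAt (ModelWithCorners.pi fun i => 𝓘(ℝ, E i)) x x)
        fun i => mem_extChartAt_target (I := 𝓘(ℝ, E i)) (x i)] with z hz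
      exact (extChartAt 𝓘(ℝ, E i) (x i)).right_inv (hz i)
    exact ⟨(continuous_apply i).continuousAt, h1.hasFDerivWithinAt⟩
  rw [h.mfderiv]
  rfl

variable [∀ i, IsManifold 𝓘(ℝ, E i) ∞ (M i)]

theorem mfderiv_extChartAt_pi_symm (hy : ∀ i, y i ∈ (extChartAt 𝓘(ℝ, E i) (p i)).target)
    (v : ∀ i, E i) (i : ι) :
    (mfderiv 𝓘(ℝ, ∀ i, E i) (ModelWithCorners.pi fun i => 𝓘(ℝ, E i))
      (extChartAt (ModelWithCorners.pi fun i => 𝓘(ℝ, E i)) p).symm y v : ∀ i, E i) i =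
      mfderiv 𝓘(ℝ, E i) 𝓘(ℝ, E i) (extChartAt 𝓘(ℝ, E i) (p i)).symm (y i) (v i) := by
  let D : ∀ i, E i →L[ℝ] E i := fun i =>
    mfderiv 𝓘(ℝ, E i) 𝓘(ℝ, E i) (extChartAt 𝓘(ℝ, E i) (p i)).symm (y i)
  have h1 : ∀ i, HasMFDerivAt 𝓘(ℝ, E i) 𝓘(ℝ, E i) (extChartAt 𝓘(ℝ, E i) (p i)).symm (y i) (D i) :=
    fun i => ((contMDiffAt_chart_symm (hy i)).mdifferentiableAt (by simp)).hasMFDerivAt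
  have h : HasMFDerivAt 𝓘(ℝ, ∀ i, E i) (ModelWithCorners.pi fun i => 𝓘(ℝ, E i))
      (extChartAt (ModelWithCorners.pi fun i => 𝓘(ℝ, E i)) p).symm y
      (ContinuousLinearMap.pi fun i => (D i).comp (ContinuousLinearMap.proj i)) := by
    have h2 : ∀ i, HasFDerivAt (fun z : E i => extChartAt 𝓘(ℝ, E i)
        ((extChartAt 𝓘(ℝ, E i) (p i)).symm (y i)) ((extChartAt 𝓘(ℝ, E i) (p i)).symm z))
        (D i) (y i) := fun i => by
      have h3 : HasFDerivWithinAt (fun z : E i => extChartAt 𝓘(ℝ, E i)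
        ((extChartAt 𝓘(ℝ, E i) (p i)).symm (y i)) ((extChartAt 𝓘(ℝ, E i) (p i)).symm z))
        (D i) (Set.range 𝓘(ℝ, E i)) (y i) := (h1 i).2
      rwa [modelWithCornersSelf_coe, Set.range_id, hasFDerivWithinAt_univ] at h3
    have h4 : HasFDerivAt (fun (z : ∀ i, E i) i => extChartAt 𝓘(ℝ, E i)
        ((extChartAt 𝓘(ℝ, E i) (p i)).symm (y i)) ((extChartAt 𝓘(ℝ, E i) (p i)).symm (z i)))
        (ContinuousLinearMap.pi fun i => (D i).comp (ContinuousLinearMap.proj i)) y :=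
      hasFDerivAt_pi.2 fun i => HasFDerivAt.comp (f := fun z : ∀ i, E i => z i) y (h2 i)
        (ContinuousLinearMap.proj (R := ℝ) (φ := E) i).hasFDerivAt
    exact ⟨continuousAt_pi.2 fun i => (h1 i).continuousAt.comp (x := y)
      (continuous_apply i).continuousAt, h4.hasFDerivWithinAt⟩
  rw [h.mfderiv]
  rfl

/-- Product charts differentiate factor by factor, so the pulled back metric has the block form
treated in coordinates. -/
theorem inChart_multiconformal (f : ι → (∀ i, M i) → ℝ)
    (g : ∀ i, BilinField 𝓘(ℝ, E i) (M := M i))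
    (hy : ∀ i, y i ∈ (extChartAt 𝓘(ℝ, E i) (p i)).target) {φ : ι → (∀ i, E i) → ℝ}
    (hφ : ∀ i, f i ((extChartAt (ModelWithCorners.pi fun i => 𝓘(ℝ, E i)) p).symm y) =
      Real.exp (φ i y)) :
    inChart (multiconformal f g) p y = multiMetric (fun i => inChart (g i) (p i)) φ y := by
  ext v w
  rw [inChart_apply, multiconformal_apply, multiMetric_apply]
  refine Finset.sum_congr rfl fun i _ => ?_
  rw [hφ, ← Real.exp_nat_mul, inChart_apply]
  have h1 := fun v : ∀ i, E i =>
    (mfderiv_eval ((extChartAt (ModelWithCorners.pi fun i => 𝓘(ℝ, E i)) p).symm y) i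
      (mfderiv 𝓘(ℝ, ∀ i, E i) (ModelWithCorners.pi fun i => 𝓘(ℝ, E i))
        (extChartAt (ModelWithCorners.pi fun i => 𝓘(ℝ, E i)) p).symm y v)).trans
      (mfderiv_extChartAt_pi_symm hy v i)
  refine congrArg₂ (· * ·) (by norm_num) ?_
  exact congrArg₂ (fun a b => (g i ((extChartAt 𝓘(ℝ, E i) (p i)).symm (y i)) :
    E i →L[ℝ] E i →L[ℝ] ℝ) a b) (h1 v) (h1 w)

end ProductCharts

/-! ### The scalar curvature formula on the product manifold -/

section ProductCurvature

variable {ι : Type*} [Fintype ι] [DecidableEq ι] {E : ι → Type*} [∀ i, NormedAddCommGroup (E i)]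
  [∀ i, NormedSpace ℝ (E i)] [∀ i, FiniteDimensional ℝ (E i)]
  {M : ι → Type*} [∀ i, TopologicalSpace (M i)]
  [∀ i, ChartedSpace (E i) (M i)] [∀ i, IsManifold 𝓘(ℝ, E i) ∞ (M i)]

/-- In product charts the slice through `x₀` in direction `j` is the affine inclusion `w ↦
Function.update c j w`. -/
theorem contMDiff_comp_update {f : (∀ i, M i) → ℝ}
    (hf : ContMDiff (ModelWithCorners.pi fun i => 𝓘(ℝ, E i)) 𝓘(ℝ, ℝ) ∞ f) (x₀ : ∀ i, M i) (j : ι) :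
    ContMDiff 𝓘(ℝ, E j) 𝓘(ℝ, ℝ) ∞ fun z => f (Function.update x₀ j z) := by
  intro z
  set p := Function.update x₀ j z with hp
  rw [contMDiffAt_iff]
  refine ⟨hf.continuous.continuousAt.comp (f := fun z => Function.update x₀ j z)
    (continuous_const.update j continuous_id).continuousAt, ?_⟩
  have h1 := (contMDiffAt_iff.1 (hf p)).2
  rw [range_pi_model, contDiffWithinAt_univ] at h1
  rw [modelWithCornersSelf_coe, Set.range_id, contDiffWithinAt_univ]
  set c : ∀ i, E i := extChartAt (ModelWithCorners.pi fun i => 𝓘(ℝ, E i)) p p with hc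
  have hcj : Function.update c j (extChartAt 𝓘(ℝ, E j) z z) = c := by
    rw [Function.update_eq_self_iff, hc, extChartAt_pi_apply, hp, Function.update_self]
  have h2 : ContDiff ℝ ∞ fun w : E j => Function.update c j w := by
    rw [contDiff_pi]
    intro i
    rcases eq_or_ne i j with rfl | hi
    · simpa using contDiff_fun_id
    · simpa [Function.update_of_ne hi] using contDiff_const
  rw [← hcj] at h1
  refine (h1.comp (extChartAt 𝓘(ℝ, E j) z z) h2.contDiffAt).congr_of_eventuallyEq (.of_eq ?_)
  ext w
  have h3 : (extChartAt (ModelWithCorners.pi fun i => 𝓘(ℝ, E i)) p).symm (Function.update c j w) =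
      Function.update x₀ j ((extChartAt 𝓘(ℝ, E j) z).symm w) := by
    ext i
    rw [extChartAt_pi_symm_apply]
    rcases eq_or_ne i j with rfl | hi
    · rw [hp, Function.update_self, Function.update_self, Function.update_self]
    · rw [Function.update_of_ne hi, Function.update_of_ne hi, hc, extChartAt_pi_apply,
        extChartAt_to_inv, hp, Function.update_of_ne hi]
  simp only [Function.comp_apply, h3]
  rfl

/-- The scalar curvature of a multiconformal metric of permutation type. -/
theorem scalarCurvature_multiconformal
    (g : ∀ i, ContMDiffRiemannianMetric 𝓘(ℝ, E i) ∞ (E i)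
      (fun x : M i => TangentSpace 𝓘(ℝ, E i) x))
    {f : ι → (∀ i, M i) → ℝ} {σ : Equiv.Perm ι} {v : ∀ i, M i → ℝ}
    (hv : ∀ i, ContMDiff 𝓘(ℝ, E i) 𝓘(ℝ, ℝ) ∞ (v i))
    (hfv : ∀ k x, f k x = Real.exp (v (σ k) (x (σ k)))) (x : ∀ i, M i) :
    scalarCurvature (multiconformal f fun i => (g i).inner) x =
      ∑ j, Real.exp (-(2 * v (σ j) (x (σ j)))) * scalarCurvature (g j).inner (x j) -
      ∑ k, Real.exp (-(2 * v (σ (σ k)) (x (σ (σ k))))) *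
        ((2 * Module.finrank ℝ (E k) - if σ k = k then 2 else 0) *
            manifoldLaplacian (g (σ k)).inner (v (σ k)) (x (σ k)) +
          (Module.finrank ℝ (E k) + (Module.finrank ℝ (E k) : ℝ) ^ 2 -
            if σ k = k then 4 * (Module.finrank ℝ (E k) : ℝ) - 2 else 0) *
            manifoldGradSq (g (σ k)).inner (v (σ k)) (x (σ k))) := by
  set y : ∀ i, E i := extChartAt (ModelWithCorners.pi fun i => 𝓘(ℝ, E i)) x x with hy
  have hyt : ∀ i, y i ∈ (extChartAt 𝓘(ℝ, E i) (x i)).target := fun i =>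
    mem_extChartAt_target (I := 𝓘(ℝ, E i)) (x i)
  have hyi : ∀ i, (extChartAt 𝓘(ℝ, E i) (x i)).symm (y i) = x i := fun i =>
    extChartAt_to_inv (I := 𝓘(ℝ, E i)) (x i)
  let U : ∀ k, E (σ k) → ℝ := fun k => v (σ k) ∘ (extChartAt 𝓘(ℝ, E (σ k)) (x (σ k))).symm
  -- The product chart at `x` is built from the preferred charts at the points `x i`, exactly those
  -- defining the scalar curvatures of the factors, so no change of chart occurs.
  have h1 : inChart (multiconformal f fun i => (g i).inner) x =ᶠ[𝓝 y]
      multiMetric (fun i => inChart (g i).inner (x i)) fun k z => U k (z (σ k)) := by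
    filter_upwards [eventually_mem_target hyt] with z hz
    exact inChart_multiconformal f _ hz fun i => hfv i _
  have h2 := coordScalarCurvature_of_permutation (σ := σ) (U := U) (y := y)
    (G := fun i => inChart (g i).inner (x i)) (fun i => isMetricAt_inChart (g i) (hyt i))
    fun k => (contDiffAt_comp_chart_symm (hv (σ k)) (hyt (σ k))).of_le (by norm_cast)
  rw [scalarCurvature, coordScalarCurvature_congr h1, h2]
  have hU : ∀ k, U k (y (σ k)) = v (σ k) (x (σ k)) := fun k => congrArg (v (σ k)) (hyi (σ k))
  simp only [hU]
  rfl

end ProductCurvature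

end Multiconformal

namespace Multiconformal

open Bundle

/-! ### Rigidity from the maximum principle -/

section Rigidity

variable {ι : Type*} [Fintype ι] [DecidableEq ι] {E : ι → Type*} [∀ i, NormedAddCommGroup (E i)]
  [∀ i, InnerProductSpace ℝ (E i)] [∀ i, FiniteDimensional ℝ (E i)]
  {M : ι → Type*} [∀ i, TopologicalSpace (M i)]
  [∀ i, ChartedSpace (E i) (M i)] [∀ i, IsManifold 𝓘(ℝ, E i) ∞ (M i)]

/-- The logarithms of conformal factors of permutation type are functions on single factors. -/
theorem HasType.exists_log {f : ι → (∀ i, M i) → ℝ} {σ : Equiv.Perm ι} (hσ : HasType f σ)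
    (hf : ∀ i, ContMDiff (ModelWithCorners.pi fun i => 𝓘(ℝ, E i)) 𝓘(ℝ, ℝ) ∞ (f i))
    (hpos : ∀ i x, 0 < f i x) (x₀ : ∀ i, M i) :
    ∃ v : ∀ i, M i → ℝ, (∀ i, ContMDiff 𝓘(ℝ, E i) 𝓘(ℝ, ℝ) ∞ (v i)) ∧
      ∀ k x, f k x = Real.exp (v (σ k) (x (σ k))) := by
  -- The functions are indexed by the factor they live on: `v (σ k)` is `log (f k)` restricted to
  -- the slice through `x₀`.
  refine ⟨fun j z => Real.log (f (σ.symm j) (Function.update x₀ j z)), fun j z => ?_,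
    fun k x => ?_⟩
  · exact (Real.contDiffAt_log.2 (hpos _ _).ne').contMDiffAt.comp z
      (contMDiff_comp_update (hf _) x₀ j z)
  · beta_reduce
    rw [Equiv.symm_apply_apply, Real.exp_log (hpos _ _)]
    exact hσ k _ _ (by rw [Function.update_self])

variable [∀ i, CompactSpace (M i)] [∀ i, ConnectedSpace (M i)]

theorem rigidity_of_hasType
    (g : ∀ i, ContMDiffRiemannianMetric 𝓘(ℝ, E i) ∞ (E i)
      (fun x : M i => TangentSpace 𝓘(ℝ, E i) x))
    (hE : ∀ i, 1 ≤ Module.finrank ℝ (E i))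
    (hg : ∀ i, ∀ p : M i, 0 ≤ scalarCurvature (g i).inner p)
    {f : ι → (∀ i, M i) → ℝ}
    (hf : ∀ i, ContMDiff (ModelWithCorners.pi fun i => 𝓘(ℝ, E i)) 𝓘(ℝ, ℝ) ∞ (f i))
    (hpos : ∀ i x, 0 < f i x) {σ : Equiv.Perm ι} (hσ : HasType f σ)
    (hR : ∀ x, scalarCurvature (multiconformal f fun i => (g i).inner) x ≤ 0) :
    (∀ i, (σ i = i → Module.finrank ℝ (E i) ≠ 1) → ∃ c : ℝ, ∀ x, f i x = c) ∧
      (∀ x, scalarCurvature (multiconformal f fun i => (g i).inner) x = 0) ∧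
      ∀ x, scalarCurvature (productMetric fun i => (g i).inner) x = 0 := by
  obtain ⟨v, hv, hfv⟩ := hσ.exists_log hf hpos fun i => Classical.arbitrary (M i)
  have hmax : ∀ j, ∃ z₀, ∀ z, v j z ≤ v j z₀ := fun j => by
    obtain ⟨z₀, -, h⟩ :=
      isCompact_univ.exists_isMaxOn Set.univ_nonempty (hv j).continuous.continuousOn
    exact ⟨z₀, fun z => h (Set.mem_univ z)⟩
  choose z₀ hz₀ using hmax
  have hlocal : ∀ j, IsLocalMax (v j) (z₀ j) := fun j => Filter.Eventually.of_forall (hz₀ j)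
  set α : ι → ℝ := fun k => 2 * Module.finrank ℝ (E k) - if σ k = k then 2 else 0 with hα
  set β : ι → ℝ := fun k => Module.finrank ℝ (E k) + (Module.finrank ℝ (E k) : ℝ) ^ 2 -
    if σ k = k then 4 * (Module.finrank ℝ (E k) : ℝ) - 2 else 0 with hβ
  set A : ∀ k, M (σ k) → ℝ := fun k z => α k * manifoldLaplacian (g (σ k)).inner (v (σ k)) z +
    β k * manifoldGradSq (g (σ k)).inner (v (σ k)) z with hA
  have key : ∀ x, scalarCurvature (multiconformal f fun i => (g i).inner) x =
      ∑ j, Real.exp (-(2 * v (σ j) (x (σ j)))) * scalarCurvature (g j).inner (x j) -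
      ∑ k, Real.exp (-(2 * v (σ (σ k)) (x (σ (σ k))))) * A k (x (σ k)) := fun x =>
    scalarCurvature_multiconformal g hv hfv x
  have hterm : ∀ x : ∀ i, M i, ∀ j, 0 ≤
      Real.exp (-(2 * v (σ j) (x (σ j)))) * scalarCurvature (g j).inner (x j) := fun x j =>
    mul_nonneg (Real.exp_pos _).le (hg j _)
  have hα0 : ∀ k, 0 ≤ α k := fun k => by
    have h : (1 : ℝ) ≤ Module.finrank ℝ (E k) := by exact_mod_cast hE k
    simp only [hα]
    split_ifs <;> linarith
  have hA0 : ∀ k, A k (z₀ (σ k)) ≤ 0 := fun k => by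
    simp only [hA]
    rw [manifoldGradSq_eq_zero _ (hlocal (σ k)), mul_zero, add_zero]
    exact mul_nonpos_of_nonneg_of_nonpos (hα0 k) (manifoldLaplacian_nonpos _ (hv _) (hlocal _))
  -- Put all coordinates except `σ k` at maximum points. The other brackets are then nonpositive, so
  -- the sign of the curvature forces the remaining one to be nonnegative; injectivity of `σ` keeps
  -- `z` out of the others.
  have hAnonneg : ∀ k z, 0 ≤ A k z := fun k z => by
    set x := Function.update z₀ (σ k) z with hx
    have h1 := hR x
    rw [key, sub_nonpos] at h1
    have h2 := (Finset.sum_nonneg fun j _ => hterm x j).trans h1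
    rw [← Finset.add_sum_erase _ _ (Finset.mem_univ k)] at h2
    have h3 : ∑ l ∈ Finset.univ.erase k,
        Real.exp (-(2 * v (σ (σ l)) (x (σ (σ l))))) * A l (x (σ l)) ≤ 0 := by
      refine Finset.sum_nonpos fun l hl => mul_nonpos_of_nonneg_of_nonpos (Real.exp_pos _).le ?_
      rw [hx, Function.update_of_ne fun h => Finset.ne_of_mem_erase hl (σ.injective h)]
      exact hA0 l
    have h4 : x (σ k) = z := Function.update_self _ _ _
    rw [h4] at h2
    exact nonneg_of_mul_nonneg_right (by linarith) (Real.exp_pos _)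
  have hconst : ∀ k, (σ k = k → Module.finrank ℝ (E k) ≠ 1) → ∃ c : ℝ, ∀ z, v (σ k) z = c := by
    intro k hk
    refine exists_eq_const_of_subsolution (g (σ k)) (hv _) (a := α k) (b := β k) ?_ (hAnonneg k)
    have h : (1 : ℝ) ≤ Module.finrank ℝ (E k) := by exact_mod_cast hE k
    simp only [hα]
    split_ifs with h1
    · have : (2 : ℝ) ≤ Module.finrank ℝ (E k) := by
        have := hE k
        have := hk h1
        exact_mod_cast (by omega : 2 ≤ Module.finrank ℝ (E k))
      linarith
    · linarith
  have hAzero : ∀ k z, A k z = 0 := fun k z => by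
    by_cases hk : σ k = k → Module.finrank ℝ (E k) ≠ 1
    · obtain ⟨c, hc⟩ := hconst k hk
      simp only [hA]
      rw [show v (σ k) = fun _ => c from funext hc, manifoldLaplacian_const, manifoldGradSq_const]
      ring
    -- For a fixed index of dimension one both coefficients vanish, `2 - 2` and `1 + 1 - (4 - 2)`,
    -- so the bracket is zero although `f k` may vary.
    · push Not at hk
      simp only [hA, hα, hβ, hk.1, hk.2, if_true]
      norm_num
  have hsum : ∀ x, scalarCurvature (multiconformal f fun i => (g i).inner) x =
      ∑ j, Real.exp (-(2 * v (σ j) (x (σ j)))) * scalarCurvature (g j).inner (x j) := fun x => by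
    rw [key]
    simp [hAzero]
  have hzero : ∀ x, scalarCurvature (multiconformal f fun i => (g i).inner) x = 0 := fun x =>
    (hR x).antisymm (by rw [hsum]; exact Finset.sum_nonneg fun j _ => hterm x j)
  have hfactor : ∀ (x : ∀ i, M i) j, scalarCurvature (g j).inner (x j) = 0 := fun x j => by
    have h := (Finset.sum_eq_zero_iff_of_nonneg fun j _ => hterm x j).1
      ((hsum x).symm.trans (hzero x)) j (Finset.mem_univ j)
    exact (mul_eq_zero.1 h).resolve_left (Real.exp_pos _).ne'
  refine ⟨fun k hk => ?_, hzero, fun x => ?_⟩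
  · obtain ⟨c, hc⟩ := hconst k hk
    exact ⟨Real.exp c, fun x => by rw [hfv, hc]⟩
  -- The direct product metric has the type of the identity with zero logarithms, so the same
  -- formula reduces its curvature to the vanishing curvatures of the factors.
  · rw [productMetric, scalarCurvature_multiconformal g (σ := 1) (v := fun _ _ => 0)
      (fun i => contMDiff_const) fun k x => Real.exp_zero.symm, Finset.sum_eq_zero fun j _ => by
      rw [hfactor, mul_zero], Finset.sum_eq_zero fun k _ => by
      rw [manifoldLaplacian_const, manifoldGradSq_const]
      ring,
      sub_zero]

end Rigidity

/-- For two factors, off-diagonal type is the type of the transposition. -/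
theorem IsOffDiagonal.hasType_swap {M : Fin 2 → Type*} {f : Fin 2 → (∀ i, M i) → ℝ}
    (hf : IsOffDiagonal f) : HasType f (Equiv.swap (0 : Fin 2) 1) := by
  intro i x y hxy
  refine hf i x y fun j hj => ?_
  have h : Equiv.swap (0 : Fin 2) 1 i = j := by
    clear hxy
    fin_cases i <;> fin_cases j <;> simp_all
  rwa [h] at hxy

end Multiconformal

end

theorem mainTheorem4 {l : ℕ} (m : Fin l → ℕ) (hm : ∀ i, 1 ≤ m i)
    (M : Fin l → Type*) [∀ i, TopologicalSpace (M i)] [∀ i, T2Space (M i)]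
    [∀ i, CompactSpace (M i)] [∀ i, ConnectedSpace (M i)]
    [∀ i, ChartedSpace (EuclideanSpace ℝ (Fin (m i))) (M i)]
    [∀ i, IsManifold (𝓡 (m i)) ∞ (M i)]
    (g : ∀ i, Bundle.ContMDiffRiemannianMetric (𝓡 (m i)) ∞ (EuclideanSpace ℝ (Fin (m i)))
      (fun x : M i => TangentSpace (𝓡 (m i)) x))
    (hg : ∀ i, ∀ p : M i, 0 ≤ Multiconformal.scalarCurvature (g i).inner p)
    (f : Fin l → (∀ i, M i) → ℝ)
    (hf : ∀ i, ContMDiff (ModelWithCorners.pi fun i => 𝓡 (m i)) 𝓘(ℝ, ℝ) ∞ (f i))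
    (hf_pos : ∀ i x, 0 < f i x) :
    (∀ σ : Equiv.Perm (Fin l), Multiconformal.HasType f σ →
      (∀ x, Multiconformal.scalarCurvature
        (Multiconformal.multiconformal f fun i => (g i).inner) x ≤ 0) →
      (∀ i, (σ i = i → m i ≠ 1) → ∃ c : ℝ, ∀ x, f i x = c) ∧
      (∀ x, Multiconformal.scalarCurvature
        (Multiconformal.multiconformal f fun i => (g i).inner) x = 0) ∧
      (∀ x, Multiconformal.scalarCurvature
        (Multiconformal.productMetric fun i => (g i).inner) x = 0)) ∧
    (l = 2 → Multiconformal.IsOffDiagonal f →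
      ¬ ((∀ x, Multiconformal.scalarCurvature
          (Multiconformal.multiconformal f fun i => (g i).inner) x ≤ 0) ∧
        ∃ x, Multiconformal.scalarCurvature
          (Multiconformal.multiconformal f fun i => (g i).inner) x < 0)) := by
  have main : ∀ σ : Equiv.Perm (Fin l), Multiconformal.HasType f σ →
      (∀ x, Multiconformal.scalarCurvature
        (Multiconformal.multiconformal f fun i => (g i).inner) x ≤ 0) →
      (∀ i, (σ i = i → m i ≠ 1) → ∃ c : ℝ, ∀ x, f i x = c) ∧
      (∀ x, Multiconformal.scalarCurvature
        (Multiconformal.multiconformal f fun i => (g i).inner) x = 0) ∧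
      (∀ x, Multiconformal.scalarCurvature
        (Multiconformal.productMetric fun i => (g i).inner) x = 0) := fun σ hσ hR => by
    have h := Multiconformal.rigidity_of_hasType g
      (fun i => by rw [finrank_euclideanSpace_fin]; exact hm i) hg hf hf_pos hσ hR
    simpa only [finrank_euclideanSpace_fin] using h
  refine ⟨main, ?_⟩
  rintro rfl hoff ⟨hle, x, hx⟩
  -- Part (a) for the transposition makes the curvature identically zero, contradicting a negative
  -- value.
  exact hx.ne ((main _ hoff.hasType_swap hle).2.1 x)
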